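/- Let $r\ge 1$ be a fixed integer. In an $r$-SP-AV election there are a finite set $\mathcal C$ of candidates and a multiset of votes, each of which is a linear order of $\mathcal C$; a vote gives one point to each candidate in its top $r$ positions and no point to the others. A winner is a candidate with the highest total score, and it is the unique winner if there is no other winner. Consider the following problem ($r$-SP-AV control by adding votes). An instance $I$ consists of a finite set $\mathcal C$ of candidates, a distinguished candidate $p\in\mathcal C$, two finite multisets $\Pi_{\mathcal V}$ (registered votes) and $\Pi_{\mathcal T}$ (unregistered votes) of linear orders of $\mathcal C$, and an integer $R$ with $0\le R\le|\Pi_{\mathcal T}|$. The question is whether there is a submultiset $\Pi_{\mathcal T'}$ of $\Pi_{\mathcal T}$ with at most $R$ elements such that $p$ is the unique winner of the $r$-SP-AV election with candidates $\mathcal C$ and votes $\Pi_{\mathcal V}\uplus\Pi_{\mathcal T'}$. For every constant $r\ge 1$ this problem is fixed-parameter tractable with respect to the number $R$ of added votes as the parameter: there are a computable function $f$ and an algorithm that decides every instance $I$ in time $f(R)\cdot|I|^{O(1)}$. More precisely, it can be solved in time $O^*\big((rR)^{(r-1)R}\big)$, that is, in at most $(rR)^{(r-1)R}\cdot q(|I|)$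 steps, where $q$ is a polynomial that depends only on $r$ (and $0^0=1$). -/

import Mathlib

/-! ### A machine model with a step count

Programs are structured `while` programs acting on binary trees (N. D. Jones' language WHILE, a
pure Lisp core): finitely many variables, each holding a tree, and the elementary operations
`nil`, `cons`, `hd`, `tl` and the test "is this tree `nil`", each at unit cost.  Since subtrees can
be shared, such programs and Turing machines or random access machines simulate each other with
polynomial overhead. -/

/-- Binary trees, the data the programs work on. -/
inductive Data : Type
  | nil : Data
  | cons : Data → Data → Data

namespace Data

/-- The number of nodes of a tree (leaves included). -/
def size : Data → ℕ
  | nil => 1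
  | cons a b => a.size + b.size + 1

/-- Left subtree (`nil` for the empty tree). -/
def hd : Data → Data
  | nil => nil
  | cons a _ => a

/-- Right subtree (`nil` for the empty tree). -/
def tl : Data → Data
  | nil => nil
  | cons _ b => b

/-- A list of trees, as a tree. -/
def ofList : List Data → Data
  | [] => nil
  | a :: l => cons a (ofList l)

/-- A bit, as a tree. -/
def ofBool : Bool → Data
  | false => nil
  | true => cons nil nil

/-- A natural number in binary, least significant bit first, as a tree. -/
def ofNat (n : ℕ) : Data := ofList (n.bits.map ofBool)

end Data

/-- Expressions; variables are numbered. -/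
inductive Expr : Type
  | var : ℕ → Expr
  | nil : Expr
  | cons : Expr → Expr → Expr
  | hd : Expr → Expr
  | tl : Expr → Expr

/-- The contents of all variables. -/
abbrev Store : Type := ℕ → Data

namespace Expr

/-- The value of an expression. -/
def eval (s : Store) : Expr → Data
  | var x => s x
  | nil => Data.nil
  | cons e f => Data.cons (e.eval s) (f.eval s)
  | hd e => (e.eval s).hd
  | tl e => (e.eval s).tl

/-- The number of elementary operations needed to evaluate an expression. -/
def cost : Expr → ℕ
  | var _ => 1
  | nil => 1
  | cons e f => e.cost + f.cost + 1
  | hd e => e.cost + 1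
  | tl e => e.cost + 1

end Expr

/-- Programs; `loop e P` is "while e do P".  A tree counts as "true" if it is not `nil`. -/
inductive Cmd : Type
  | skip : Cmd
  | assign : ℕ → Expr → Cmd
  | seq : Cmd → Cmd → Cmd
  | ite : Expr → Cmd → Cmd → Cmd
  | loop : Expr → Cmd → Cmd

/-- `Exec P s t s'`: started on the store `s`, the program `P` halts after exactly `t` elementary
steps, with the store `s'`. -/
inductive Exec : Cmd → Store → ℕ → Store → Prop
  | skip (s : Store) : Exec Cmd.skip s 1 s
  | assign (x : ℕ) (e : Expr) (s : Store) :
      Exec (Cmd.assign x e) s (e.cost + 1) (Function.update s x (e.eval s))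
  | seq {P Q : Cmd} {s s' s'' : Store} {t u : ℕ} (h : Exec P s t s') (k : Exec Q s' u s'') :
      Exec (Cmd.seq P Q) s (t + u) s''
  | iteTrue {e : Expr} {P Q : Cmd} {s s' : Store} {t : ℕ} (he : e.eval s ≠ Data.nil)
      (h : Exec P s t s') : Exec (Cmd.ite e P Q) s (e.cost + 1 + t) s'
  | iteFalse {e : Expr} {P Q : Cmd} {s s' : Store} {t : ℕ} (he : e.eval s = Data.nil)
      (h : Exec Q s t s') : Exec (Cmd.ite e P Q) s (e.cost + 1 + t) s'
  | loopTrue {e : Expr} {P : Cmd} {s s' s'' : Store} {t u : ℕ} (he : e.eval s ≠ Data.nil)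
      (h : Exec P s t s') (k : Exec (Cmd.loop e P) s' u s'') :
      Exec (Cmd.loop e P) s (e.cost + 1 + t + u) s''
  | loopFalse {e : Expr} {P : Cmd} {s : Store} (he : e.eval s = Data.nil) :
      Exec (Cmd.loop e P) s (e.cost + 1) s

/-- The initial store: the input is in variable `0`, all other variables are `nil`. -/
def inputStore (d : Data) : Store := Function.update (fun _ => Data.nil) 0 d

/-- The program `P` decides the problem with instances `a : α` (given to it as `enc a`) and
yes-instances `yes`, and takes at most `time a` steps on every instance `a`.  The answer is read
off variable `0`: `nil` means no, every other tree means yes. -/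
def DecidesInTime {α : Type} (P : Cmd) (enc : α → Data) (yes : α → Prop) (time : α → ℕ) : Prop :=
  ∀ a : α, ∃ (t : ℕ) (s : Store),
    Exec P (inputStore (enc a)) t s ∧ t ≤ time a ∧ (s 0 ≠ Data.nil ↔ yes a)

/-- Solvable in time `O*(g)`: some program decides the problem in at most `g a` times a polynomial
in the size of the encoded instance many steps. -/
def SolvableInOStar {α : Type} (enc : α → Data) (yes : α → Prop) (g : α → ℕ) : Prop :=
  ∃ (P : Cmd) (q : Polynomial ℕ), DecidesInTime P enc yes (fun a => g a * q.eval (enc a).size)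

/-- Fixed-parameter tractability with respect to the parameter `κ`: solvable in time
`f(κ) * |I|^O(1)` for some computable function `f`. -/
def IsFPT {α : Type} (enc : α → Data) (yes : α → Prop) (κ : α → ℕ) : Prop :=
  ∃ f : ℕ → ℕ, Computable f ∧ SolvableInOStar enc yes (fun a => f (κ a))

/-! ### Elections -/

/-- A vote over the candidates `0, …, m - 1`: a linear order of all candidates, given by the
bijection that sends a place `i` (`0` is the top) to the candidate ranked there. -/
abbrev Vote (m : ℕ) : Type := Equiv.Perm (Fin m)

/-- A vote approves exactly its top `r` candidates. -/
def Vote.Approves {m : ℕ} (r : ℕ) (v : Vote m) (c : Fin m) : Prop := (v.symm c : ℕ) < r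

instance {m : ℕ} (r : ℕ) (v : Vote m) (c : Fin m) : Decidable (Vote.Approves r v c) :=
  inferInstanceAs (Decidable ((v.symm c : ℕ) < r))

/-- The total score of a candidate: the number of votes approving it. -/
def score {m : ℕ} (r : ℕ) (W : Multiset (Vote m)) (c : Fin m) : ℕ :=
  W.countP (fun v => Vote.Approves r v c)

/-- A winner is a candidate with the highest total score. -/
def IsWinner {m : ℕ} (r : ℕ) (W : Multiset (Vote m)) (c : Fin m) : Prop :=
  ∀ d : Fin m, score r W d ≤ score r W c

/-- `c` is the only winner. -/
def IsUniqueWinner {m : ℕ} (r : ℕ) (W : Multiset (Vote m)) (c : Fin m) : Prop :=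
  IsWinner r W c ∧ ∀ d : Fin m, IsWinner r W d → d = c

/-- An instance of control by adding votes. -/
structure AVInstance : Type where
  /-- the number of candidates, the distinguished one included -/
  m : ℕ
  /-- the distinguished candidate -/
  p : Fin m
  /-- the registered votes -/
  registered : List (Vote m)
  /-- the unregistered votes -/
  unregistered : List (Vote m)
  /-- the number of votes that may be added -/
  R : ℕ
  R_le : R ≤ unregistered.length

namespace AVInstance

/-- The question of control by adding votes: can the distinguished candidate be made the unique
winner by adding at most `R` of the unregistered votes? -/
def IsYes (r : ℕ) (I : AVInstance) : Prop :=
  ∃ S : Multiset (Vote I.m), S ≤ (I.unregistered : Multiset (Vote I.m)) ∧ S.card ≤ I.R ∧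
    IsUniqueWinner r ((I.registered : Multiset (Vote I.m)) + S) I.p

/-- A vote as input: the list of the candidates, from top to bottom. -/
def encodeVote {m : ℕ} (v : Vote m) : Data :=
  Data.ofList ((List.finRange m).map fun i => Data.ofNat (v i))

/-- An instance as input: the list consisting of the list of candidates, the distinguished
candidate, the two lists of votes, and `R`; all numbers in binary. -/
def encode (I : AVInstance) : Data :=
  Data.ofList
    [Data.ofList ((List.range I.m).map Data.ofNat), Data.ofNat I.p,
      Data.ofList (I.registered.map encodeVote), Data.ofList (I.unregistered.map encodeVote),
      Data.ofNat I.R]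

end AVInstance

/-! Only votes approving p are worth adding, and as many of them as permitted: deleting any other
vote costs p nothing, and a further supporter raises p by one and each rival by at most one
(`exists_supporters_of_isYes`). Hence the number k of added votes and the final score t of p are
known in advance. Each supporter becomes the set of the rivals it approves; these sets all have the
same size, at most d = r - 1. One has to choose k of them, respecting multiplicities, so that every
rival stays below t. A set is usable only if each of its rivals can receive one point and still stay
below t.

Few sets suffice. Put B = rR and run greedily through the usable sets, rejecting a set if it has a
subset S already contained in B^(d - |S|) kept sets. The case S = ∅ shows that at most B^d sets are
kept (`length_kernel_le`). If a usable set avoids some F with |F| < B, then so does some kept set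
(`kernel_represents`): otherwise every kept set containing the saturated S would contain S ∪ {f} for
some f in F, which gives at most |F| B^(d - |S| - 1) < B^(d - |S|) such sets.

Now exchange (`exists_solution_of_represents`). Given a solution that uses a set v that is not kept,
let F consist of the rivals that occur in the other k - 1 sets but not in v, and replace v by a kept
usable set u avoiding F. A rival of u outside v occurs only in u, and one point is harmless to it;
the counts of all other rivals do not grow. Repetition yields a solution made of kept sets only.

It remains to test all words of length k over at most B^d letters, that is, at most (rR)^((r-1)R)
candidates if R > 0, each in polynomial time. The search is an odometer (`advance`,
`search_result`). That its steps are polynomial on the machine model is shown compositionally,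
through closure properties of `PolyTime`. -/

/-! ### Polynomial-time functions between encoded types -/

/-- Types whose elements are represented by trees. -/
class Coded (α : Type) where
  /-- the representation of an element -/
  code : α → Data

open Coded

/-- The size of the representation of an element. -/
def csize {α : Type} [Coded α] (a : α) : ℕ := (code a).size

instance : Coded Data := ⟨id⟩
instance : Coded Bool := ⟨Data.ofBool⟩
instance {α β : Type} [Coded α] [Coded β] : Coded (α × β) := ⟨fun x => .cons (code x.1) (code x.2)⟩
instance {α : Type} [Coded α] : Coded (List α) := ⟨fun l => Data.ofList (l.map code)⟩
/-- Outside of the inputs, natural numbers are represented in unary. -/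
instance : Coded ℕ := ⟨fun n => Data.ofList (List.replicate n Data.nil)⟩
instance {α : Type} [Coded α] (p : α → Prop) : Coded (Subtype p) := ⟨fun x => code x.1⟩
instance : Coded AVInstance := ⟨AVInstance.encode⟩

theorem Polynomial.eval_nat_mono (q : Polynomial ℕ) {m n : ℕ} (h : m ≤ n) :
    q.eval m ≤ q.eval n := by
  simp only [Polynomial.eval_eq_sum_range]
  gcongr

theorem Data.one_le_size (d : Data) : 1 ≤ d.size := by
  cases d <;> simp [Data.size]

theorem one_le_csize {α : Type} [Coded α] (a : α) : 1 ≤ csize a := Data.one_le_size _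

/-- `Run P s T s'`: started on `s`, the program `P` halts within `T` steps, with the store `s'`. -/
def Run (P : Cmd) (s : Store) (T : ℕ) (s' : Store) : Prop := ∃ t ≤ T, Exec P s t s'

namespace Run

theorem mono {P : Cmd} {s s' : Store} {T U : ℕ} (h : Run P s T s') (hTU : T ≤ U) :
    Run P s U s' := by
  obtain ⟨t, ht, he⟩ := h
  exact ⟨t, ht.trans hTU, he⟩

theorem assign (x : ℕ) (e : Expr) (s : Store) :
    Run (.assign x e) s (e.cost + 1) (Function.update s x (e.eval s)) :=
  ⟨_, le_rfl, .assign x e s⟩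

theorem seq {P Q : Cmd} {s s' s'' : Store} {T U : ℕ} (h : Run P s T s') (k : Run Q s' U s'') :
    Run (.seq P Q) s (T + U) s'' := by
  obtain ⟨t, ht, he⟩ := h
  obtain ⟨u, hu, hf⟩ := k
  exact ⟨t + u, add_le_add ht hu, .seq he hf⟩

theorem iteTrue {e : Expr} {P Q : Cmd} {s s' : Store} {T : ℕ} (he : e.eval s ≠ Data.nil)
    (h : Run P s T s') : Run (.ite e P Q) s (e.cost + 1 + T) s' := by
  obtain ⟨t, ht, hx⟩ := h
  exact ⟨_, by gcongr, .iteTrue he hx⟩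

theorem iteFalse {e : Expr} {P Q : Cmd} {s s' : Store} {T : ℕ} (he : e.eval s = Data.nil)
    (h : Run Q s T s') : Run (.ite e P Q) s (e.cost + 1 + T) s' := by
  obtain ⟨t, ht, hx⟩ := h
  exact ⟨_, by gcongr, .iteFalse he hx⟩

theorem loopTrue {e : Expr} {P : Cmd} {s s' s'' : Store} {T U : ℕ} (he : e.eval s ≠ Data.nil)
    (h : Run P s T s') (k : Run (.loop e P) s' U s'') :
    Run (.loop e P) s (e.cost + 1 + T + U) s'' := by
  obtain ⟨t, ht, hx⟩ := h
  obtain ⟨u, hu, hy⟩ := k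
  exact ⟨_, by gcongr, .loopTrue he hx hy⟩

theorem loopFalse {e : Expr} {P : Cmd} {s : Store} (he : e.eval s = Data.nil) :
    Run (.loop e P) s (e.cost + 1) s :=
  ⟨_, le_rfl, .loopFalse he⟩

end Run

/-- The program `P` turns `a` into `f a` in variable `0`, whatever the other variables hold, and
leaves all variables from `n` on untouched; its running time and the size of `f a` are at most
`q` of the size of `a`. -/
def ComputesIn {α β : Type} [Coded α] [Coded β] (P : Cmd) (n : ℕ) (q : Polynomial ℕ)
    (f : α → β) : Prop :=
  0 < n ∧ ∀ (a : α) (s : Store), s 0 = code a → csize (f a) ≤ q.eval (csize a) ∧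
    ∃ s', Run P s (q.eval (csize a)) s' ∧ s' 0 = code (f a) ∧ ∀ x, n ≤ x → s' x = s x

/-- Functions computable in polynomial time, with values of polynomial size. -/
@[fun_prop]
def PolyTime {α β : Type} [Coded α] [Coded β] (f : α → β) : Prop :=
  ∃ (P : Cmd) (n : ℕ) (q : Polynomial ℕ), ComputesIn P n q f

namespace PolyTime

variable {α β γ δ σ : Type} [Coded α] [Coded β] [Coded γ] [Coded δ] [Coded σ]

theorem size_le {f : α → β} (hf : PolyTime f) :
    ∃ q : Polynomial ℕ, ∀ a, csize (f a) ≤ q.eval (csize a) := by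
  obtain ⟨P, n, q, -, h⟩ := hf
  exact ⟨q, fun a => (h a (fun _ => code a) rfl).1⟩

/-- The same program serves, since only representations matter. This allows retyping a value at no
cost. -/
theorem of_code_eq {f : α → β} {g : α → γ} (hf : PolyTime f) (h : ∀ a, code (g a) = code (f a)) :
    PolyTime g := by
  obtain ⟨P, n, q, hn, hP⟩ := hf
  refine ⟨P, n, q, hn, fun a s hs => ?_⟩
  have := hP a s hs
  simpa only [csize, h a] using this

/-- One assignment to variable `0`. -/
theorem of_expr {f : α → β} (e : Expr) (q : Polynomial ℕ)
    (he : ∀ a (s : Store), s 0 = code a → e.eval s = code (f a))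
    (hq : ∀ a, csize (f a) ≤ q.eval (csize a)) : PolyTime f := by
  refine ⟨.assign 0 e, 1, q + Polynomial.C (e.cost + 1), one_pos, fun a s hs => ⟨?_, _,
    (Run.assign 0 e s).mono ?_, ?_, fun x hx => ?_⟩⟩
  · simpa using (hq a).trans (Nat.le_add_right _ _)
  · simp
  · simpa using he a s hs
  · rw [Function.update_of_ne (by omega)]

theorem of_code_eq_input {f : α → β} (h : ∀ a, code (f a) = code a) : PolyTime f :=
  of_expr (.var 0) Polynomial.X (fun a s hs => by simp [Expr.eval, hs, h])
    (fun a => by simp [csize, h])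

@[fun_prop]
theorem id : PolyTime (fun a : α => a) := of_code_eq_input fun _ => rfl

theorem size_hd_le (d : Data) : d.hd.size ≤ d.size := by
  cases d <;> simp [Data.hd, Data.size]; omega

theorem size_tl_le (d : Data) : d.tl.size ≤ d.size := by
  cases d <;> simp [Data.tl, Data.size]; omega

theorem of_hd {f : α → β} (h : ∀ a, code (f a) = (code a).hd) : PolyTime f :=
  of_expr (.hd (.var 0)) Polynomial.X (fun a s hs => by simp [Expr.eval, hs, h])
    (fun a => by simpa [csize, h] using size_hd_le _)

theorem of_tl {f : α → β} (h : ∀ a, code (f a) = (code a).tl) : PolyTime f :=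
  of_expr (.tl (.var 0)) Polynomial.X (fun a s hs => by simp [Expr.eval, hs, h])
    (fun a => by simpa [csize, h] using size_tl_le _)

/-- The expression with constant value `d`. -/
def constExpr : Data → Expr
  | .nil => .nil
  | .cons a b => .cons (constExpr a) (constExpr b)

theorem eval_constExpr (d : Data) (s : Store) : (constExpr d).eval s = d := by
  induction d with
  | nil => rfl
  | cons a b iha ihb => simp [constExpr, Expr.eval, iha, ihb]

@[fun_prop]
theorem const (b : β) : PolyTime (fun _ : α => b) :=
  of_expr (constExpr (code b)) (Polynomial.C (csize b)) (fun _ _ _ => eval_constExpr _ _)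
    (fun a => by simp)

theorem comp {f : β → γ} {g : α → β} (hf : PolyTime f) (hg : PolyTime g) :
    PolyTime (fun a => f (g a)) := by
  obtain ⟨P, n, q, hn, hP⟩ := hf
  obtain ⟨Q, m, r, hm, hQ⟩ := hg
  refine ⟨.seq Q P, n + m, r + q.comp r, by omega, fun a s hs => ?_⟩
  obtain ⟨h1, s1, r1, e1, f1⟩ := hQ a s hs
  obtain ⟨h2, s2, r2, e2, f2⟩ := hP (g a) s1 e1
  have h3 := q.eval_nat_mono h1
  simp only [Polynomial.eval_add, Polynomial.eval_comp]
  exact ⟨by omega, s2, (r1.seq r2).mono (by omega), e2,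
    fun x hx => by rw [f2 x (by omega), f1 x (by omega)]⟩

/-- Values that are pairs of values of two functions. -/
theorem of_cons {f : α → β} {g : α → γ} {h : α → δ} (hf : PolyTime f) (hg : PolyTime g)
    (hh : ∀ a, code (h a) = .cons (code (f a)) (code (g a))) : PolyTime h := by
  obtain ⟨P, n, q, hn, hP⟩ := hf
  obtain ⟨Q, m, r, hm, hQ⟩ := hg
  -- Variables `n + m` and `n + m + 1` lie beyond those that `P` and `Q` may touch, so they can hold
  -- the input and the first result.
  refine ⟨.seq (.assign (n + m) (.var 0)) (.seq P (.seq (.assign (n + m + 1) (.var 0))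
    (.seq (.assign 0 (.var (n + m))) (.seq Q (.assign 0 (.cons (.var (n + m + 1)) (.var 0))))))),
    n + m + 2, q + r + 10, by omega, fun a s hs => ?_⟩
  obtain ⟨h1, s1, r1, e1, f1⟩ := hP a (Function.update s (n + m) (s 0))
    (by rw [Function.update_of_ne (by omega), hs])
  obtain ⟨h2, s2, r2, e2, f2⟩ := hQ a
    (Function.update (Function.update s1 (n + m + 1) (s1 0)) 0 (s1 (n + m)))
    (by rw [Function.update_self, f1 _ (by omega), Function.update_self, hs])
  have hc : csize (h a) = csize (f a) + csize (g a) + 1 := by simp [csize, hh, Data.size]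
  have hev : (q + r + 10).eval (csize a) = q.eval (csize a) + r.eval (csize a) + 10 := by
    simp
  rw [hev]
  refine ⟨by omega, Function.update s2 0 (.cons (s2 (n + m + 1)) (s2 0)),
    (Run.seq (Run.assign _ _ _) (Run.seq r1 (Run.seq (Run.assign _ _ _) (Run.seq
      (s' := Function.update (Function.update s1 (n + m + 1) (s1 0)) 0 (s1 (n + m))) ?_
      (Run.seq r2 (Run.assign _ _ _)))))).mono (T := 2 + (q.eval (csize a) + (2 + (2 +
        (r.eval (csize a) + 4))))) (by omega), ?_, fun x hx => ?_⟩
  · have := Run.assign 0 (.var (n + m)) (Function.update s1 (n + m + 1) (s1 0))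
    rwa [Expr.eval, Function.update_of_ne (by omega)] at this
  · rw [Function.update_self, f2 _ (by omega), Function.update_of_ne (by omega),
      Function.update_self, e1, e2, hh]
  · rw [Function.update_of_ne (by omega), f2 _ (by omega), Function.update_of_ne (by omega),
      Function.update_of_ne (by omega), f1 _ (by omega), Function.update_of_ne (by omega)]

@[fun_prop]
theorem mk {f : α → β} {g : α → γ} (hf : PolyTime f) (hg : PolyTime g) :
    PolyTime (fun a => (f a, g a)) := of_cons hf hg fun _ => rfl

@[fun_prop]
theorem fst {f : α → β × γ} (hf : PolyTime f) : PolyTime (fun a => (f a).1) :=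
  comp (f := Prod.fst) (of_hd fun _ => rfl) hf

@[fun_prop]
theorem snd {f : α → β × γ} (hf : PolyTime f) : PolyTime (fun a => (f a).2) :=
  comp (f := Prod.snd) (of_tl fun _ => rfl) hf

@[fun_prop]
theorem list_cons {f : α → β} {g : α → List β} (hf : PolyTime f) (hg : PolyTime g) :
    PolyTime (fun a => f a :: g a) := of_cons hf hg fun _ => rfl

@[fun_prop]
theorem list_tail {f : α → List β} (hf : PolyTime f) : PolyTime (fun a => (f a).tail) :=
  comp (f := List.tail) (of_tl fun l => by cases l <;> rfl) hf

theorem val {p : β → Prop} {f : α → Subtype p} (hf : PolyTime f) :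
    PolyTime (fun a => (f a).1) :=
  comp (f := Subtype.val) (of_code_eq_input fun _ => rfl) hf

theorem subtype_mk {p : β → Prop} {f : α → β} (hf : PolyTime f) (h : ∀ a, p (f a)) :
    PolyTime (fun a => (⟨f a, h a⟩ : Subtype p)) :=
  of_code_eq hf fun _ => rfl

/-- Case distinction, under the promises that hold in the two cases. -/
theorem dite {c : α → Bool} {f : {a // c a = true} → β} {g : {a // c a = false} → β}
    (hc : PolyTime c) (hf : PolyTime f) (hg : PolyTime g) :
    PolyTime (fun a => if h : c a = true then f ⟨a, h⟩ else g ⟨a, by simpa using h⟩) := by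
  obtain ⟨C, k, p, hk, hC⟩ := hc
  obtain ⟨P, n, q, hn, hP⟩ := hf
  obtain ⟨Q, m, r, hm, hQ⟩ := hg
  refine ⟨.seq (.assign (k + n + m) (.var 0)) (.seq C (.seq (.assign (k + n + m + 1) (.var 0))
    (.seq (.assign 0 (.var (k + n + m))) (.ite (.var (k + n + m + 1)) P Q)))),
    k + n + m + 2, p + q + r + 10, by omega, fun a s hs => ?_⟩
  obtain ⟨-, s1, r1, e1, f1⟩ := hC a (Function.update s (k + n + m) (s 0))
    (by rw [Function.update_of_ne (by omega), hs])
  have hs2 : Function.update (Function.update s1 (k + n + m + 1) (s1 0)) 0 (s1 (k + n + m)) 0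
      = code a := by rw [Function.update_self, f1 _ (by omega), Function.update_self, hs]
  have hstep : Run (.assign 0 (.var (k + n + m))) (Function.update s1 (k + n + m + 1) (s1 0)) 2
      (Function.update (Function.update s1 (k + n + m + 1) (s1 0)) 0 (s1 (k + n + m))) := by
    have := Run.assign 0 (.var (k + n + m)) (Function.update s1 (k + n + m + 1) (s1 0))
    rwa [Expr.eval, Function.update_of_ne (by omega)] at this
  have hev : (p + q + r + 10).eval (csize a)
      = p.eval (csize a) + q.eval (csize a) + r.eval (csize a) + 10 := by
    simp
  have hfr : ∀ x, k + n + m + 2 ≤ x → Function.update (Function.update s1 (k + n + m + 1) (s1 0))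
      0 (s1 (k + n + m)) x = s x := fun x hx => by
    rw [Function.update_of_ne (by omega), Function.update_of_ne (by omega), f1 _ (by omega),
      Function.update_of_ne (by omega)]
  have htest : (Expr.var (k + n + m + 1)).eval (Function.update (Function.update s1
      (k + n + m + 1) (s1 0)) 0 (s1 (k + n + m))) = code (c a) := by
    simp only [Expr.eval]
    rw [Function.update_of_ne (by omega), Function.update_self, e1]
  rw [hev]
  beta_reduce
  by_cases h : c a = true
  swap
  · rw [Bool.not_eq_true] at h
    obtain ⟨h2, s2, r2, e2, f2⟩ := hQ ⟨a, h⟩ _ hs2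
    change csize _ ≤ r.eval (csize a) at h2
    change Run _ _ (r.eval (csize a)) _ at r2
    rw [dif_neg (by simp [h])]
    refine ⟨by omega, s2, (Run.seq (Run.assign _ _ _) (Run.seq r1 (Run.seq (Run.assign _ _ _)
      (Run.seq hstep (Run.iteFalse (by rw [htest, h]; rfl) r2))))).mono ?_, e2,
      fun x hx => by rw [f2 x (by omega), hfr x hx]⟩
    simp only [Expr.cost]; omega
  · obtain ⟨h2, s2, r2, e2, f2⟩ := hP ⟨a, h⟩ _ hs2
    change csize _ ≤ q.eval (csize a) at h2
    change Run _ _ (q.eval (csize a)) _ at r2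
    rw [dif_pos h]
    refine ⟨by omega, s2, (Run.seq (Run.assign _ _ _) (Run.seq r1 (Run.seq (Run.assign _ _ _)
      (Run.seq hstep (Run.iteTrue (by rw [htest, h]; exact nofun) r2))))).mono ?_, e2,
      fun x hx => by rw [f2 x (by omega), hfr x hx]⟩
    simp only [Expr.cost]; omega

@[fun_prop]
theorem cond {c : α → Bool} {f g : α → β} (hc : PolyTime c) (hf : PolyTime f) (hg : PolyTime g) :
    PolyTime (fun a => bif c a then f a else g a) := by
  have h := dite hc (f := fun a => f a.1) (g := fun a => g a.1) (hf.comp (val id))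
    (hg.comp (val id))
  convert h using 2 with a
  split_ifs with h1 <;> simp [h1]

theorem of_isNil {f : α → Bool} (h : ∀ a, f a = true ↔ code a = Data.nil) : PolyTime f := by
  refine ⟨.ite (.var 0) (.assign 0 .nil) (.assign 0 (.cons .nil .nil)), 1, 10, one_pos,
    fun a s hs => ?_⟩
  rw [show (10 : Polynomial ℕ).eval (csize a) = 10 by simp]
  refine ⟨?_, ?_⟩
  · cases f a <;> simp [csize, code, Data.ofBool, Data.size]
  rcases hfa : f a with _ | _
  · have hne : ¬ code a = Data.nil := by rw [← h a, hfa]; simp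
    exact ⟨_, (Run.iteTrue (by simpa [Expr.eval, hs] using hne) (Run.assign _ _ _)).mono
      (by simp [Expr.cost]), by simp [Expr.eval, code, Data.ofBool],
      fun x hx => Function.update_of_ne (by omega) _ _⟩
  · exact ⟨_, (Run.iteFalse (by simpa [Expr.eval, hs] using (h a).1 hfa) (Run.assign _ _ _)).mono
      (by simp [Expr.cost]), by simp [Expr.eval, code, Data.ofBool],
      fun x hx => Function.update_of_ne (by omega) _ _⟩

/-- Iterating a polynomial-time step on states of bounded size. -/
theorem exec_loop {c : σ → Prop} (hc : ∀ x, (code x).hd ≠ Data.nil ↔ c x)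
    {f : {x // c x} → σ} (hf : PolyTime f) :
    ∃ (P : Cmd) (n : ℕ) (q : Polynomial ℕ), 0 < n ∧ ∀ (B N : ℕ) (x : ℕ → σ),
      (∀ i < N, ∃ h : c (x i), x (i + 1) = f ⟨x i, h⟩) → ¬ c (x N) → (∀ i ≤ N, csize (x i) ≤ B) →
      ∀ s : Store, s 0 = code (x 0) → ∃ s', Run P s ((N + 1) * q.eval B) s' ∧
        s' 0 = code (x N) ∧ ∀ y, n ≤ y → s' y = s y := by
  obtain ⟨P, n, q, hn, hP⟩ := hf
  refine ⟨.loop (.hd (.var 0)) P, n, q + 3, hn, fun B N => ?_⟩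
  have hev : (q + 3).eval B = q.eval B + 3 := by simp
  rw [hev]
  induction N with
  | zero =>
    intro x _ hN _ s hs
    have : (code (x 0)).hd = Data.nil := by by_contra h; exact hN ((hc _).1 h)
    exact ⟨s, (Run.loopFalse (by simpa [Expr.eval, hs] using this)).mono
      (by simp only [Expr.cost]; omega), hs, fun _ _ => rfl⟩
  | succ N ih =>
    intro x hx hN hB s hs
    obtain ⟨h0, hx1⟩ := hx 0 (by omega)
    obtain ⟨-, s1, r1, e1, f1⟩ := hP ⟨x 0, h0⟩ s hs
    obtain ⟨s2, r2, e2, f2⟩ := ih (fun i => x (i + 1)) (fun i hi => hx (i + 1) (by omega)) hN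
      (fun i hi => hB (i + 1) (by omega)) s1 (by rw [e1, ← hx1])
    have hq : q.eval (csize (x 0)) ≤ q.eval B := q.eval_nat_mono (hB 0 (by omega))
    change Run P s (q.eval (csize (x 0))) s1 at r1
    refine ⟨s2, (Run.loopTrue (by simpa [Expr.eval, hs] using (hc _).2 h0) r1 r2).mono ?_, e2,
      fun y hy => by rw [f2 y hy, f1 y hy]⟩
    simp only [Expr.cost]
    have : (N + 1 + 1) * (q.eval B + 3) = (N + 1) * (q.eval B + 3) + (q.eval B + 3) := by ring
    omega

end PolyTime

/-! ### Sizes of representations -/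

section Sizes

variable {α β : Type} [Coded α] [Coded β]

@[simp]
theorem csize_nil : csize ([] : List α) = 1 := rfl

@[simp]
theorem csize_cons (a : α) (l : List α) : csize (a :: l) = csize a + csize l + 1 := rfl

@[simp]
theorem csize_mk (a : α) (b : β) : csize (a, b) = csize a + csize b + 1 := rfl

@[simp]
theorem csize_nat (n : ℕ) : csize n = 2 * n + 1 := by
  induction n with
  | zero => rfl
  | succ n ih =>
    change (Data.ofList (List.replicate (n + 1) _)).size = _
    change (Data.ofList (List.replicate n _)).size = _ at ih
    simp only [List.replicate_succ, Data.ofList, Data.size, ih]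
    ring

theorem csize_bool_le (b : Bool) : csize b ≤ 3 := by
  cases b <;> simp [csize, code, Data.ofBool, Data.size]

theorem csize_append (l l' : List α) : csize (l ++ l') + 1 = csize l + csize l' := by
  induction l with
  | nil => simp; omega
  | cons a l ih => simp; omega

theorem csize_reverse (l : List α) : csize l.reverse = csize l := by
  induction l with
  | nil => rfl
  | cons a l ih =>
    have := csize_append l.reverse [a]
    simp at this ⊢
    omega

theorem List.Sublist.csize_le {l l' : List α} (h : l.Sublist l') : csize l ≤ csize l' := by
  induction h with
  | slnil => rfl
  | cons a _ ih => simp; omega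
  | cons_cons a _ ih => simp; omega

theorem csize_le_of_mem {a : α} {l : List α} (h : a ∈ l) : csize a ≤ csize l := by
  induction l with
  | nil => simp at h
  | cons b l ih =>
    rcases List.mem_cons.1 h with rfl | h
    · simp; omega
    · have := ih h
      simp; omega

theorem length_le_csize (l : List α) : l.length ≤ csize l := by
  induction l with
  | nil => simp
  | cons b l ih => simp; omega

theorem csize_le_length_mul {l : List α} {B : ℕ} (h : ∀ a ∈ l, csize a ≤ B) :
    csize l ≤ l.length * (B + 1) + 1 := by
  induction l with
  | nil => simp
  | cons b l ih =>
    have h1 := ih fun a ha => h a (List.mem_cons_of_mem _ ha)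
    have h2 := h b List.mem_cons_self
    simp only [csize_cons, List.length_cons, Nat.add_mul, one_mul]
    omega

end Sizes

/-! ### Closure of polynomial time under list operations, Boolean operations and arithmetic -/

namespace PolyTime

variable {α β γ δ σ : Type} [Coded α] [Coded β] [Coded γ] [Coded δ] [Coded σ]

theorem list_head {l : α → List β} (hl : PolyTime l) (h : ∀ a, l a ≠ []) :
    PolyTime (fun a => (l a).head (h a)) :=
  comp (f := fun x : {l : List β // l ≠ []} => x.1.head x.2)
    (of_hd fun ⟨x, hx⟩ => by
      cases x with
      | nil => exact absurd rfl hx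
      | cons => rfl)
    (subtype_mk hl h)

/-- The loop state consists of the remaining list, the accumulator and the input. Iterating a
polynomial-time step can make the accumulator grow exponentially, so a polynomial bound is demanded
for every intermediate accumulator, that is, for the fold over every prefix. -/
theorem list_foldl {l : α → List β} {s : α → σ} {g : α → σ → β → σ} (hl : PolyTime l)
    (hs : PolyTime s) (hg : PolyTime fun x : α × σ × β => g x.1 x.2.1 x.2.2) (q : Polynomial ℕ)
    (hq : ∀ a l', l' <+: l a → csize (l'.foldl (g a) (s a)) ≤ q.eval (csize a)) :
    PolyTime (fun a => (l a).foldl (g a) (s a)) := by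
  have hpre : PolyTime (fun a => (l a, s a, a)) := by fun_prop
  have hstep : PolyTime (fun x : {x : List β × σ × α // x.1 ≠ []} =>
      (x.1.1.tail, g x.1.2.2 x.1.2.1 (x.1.1.head x.2), x.1.2.2)) := by
    have hv : PolyTime (fun x : {x : List β × σ × α // x.1 ≠ []} => x.1) := val id
    refine mk (by fun_prop) (mk (hg.comp (mk (by fun_prop) (mk (by fun_prop) ?_)))
      (by fun_prop))
    exact list_head (by fun_prop) fun x => x.2
  have hc : ∀ x : List β × σ × α, (code x).hd ≠ Data.nil ↔ x.1 ≠ [] := by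
    rintro ⟨_ | ⟨b, l⟩, x⟩
    · exact iff_of_false (fun h => h rfl) (fun h => h rfl)
    · exact iff_of_true nofun nofun
  obtain ⟨P, n, p, hn, hP⟩ := hpre
  obtain ⟨Q, m, r, hm, hQ⟩ := exec_loop hc hstep
  refine ⟨.seq P (.seq Q (.assign 0 (.hd (.tl (.var 0))))), n + m,
    p + (p + 1) * r.comp (p + q + Polynomial.X + 2) + q + 4, by omega, fun a s0 h0 => ?_⟩
  obtain ⟨h1, s1, r1, e1, f1⟩ := hP a s0 h0
  have hlen := length_le_csize (l a)
  simp only [csize_mk] at h1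
  obtain ⟨s2, r2, e2, f2⟩ := hQ (p.eval (csize a) + q.eval (csize a) + csize a + 2) (l a).length
    (fun i => ((l a).drop i, ((l a).take i).foldl (g a) (s a), a)) (fun i hi => by
      refine ⟨by simpa using hi, ?_⟩
      simp only [List.take_succ_eq_append_getElem hi, List.foldl_append, List.foldl_cons,
        List.foldl_nil, List.tail_drop, List.head_drop]) (by simp) (fun i _ => by
      have h2 := hq a _ (List.take_prefix i (l a))
      have h3 := (List.drop_sublist i (l a)).csize_le
      simp only [csize_mk]
      omega) s1 (by simpa using e1)
  have hfull := hq a _ (List.prefix_refl _)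
  simp only [Polynomial.eval_add, Polynomial.eval_mul, Polynomial.eval_comp, Polynomial.eval_X,
    Polynomial.eval_one, Polynomial.eval_ofNat]
  have hmul := Nat.mul_le_mul_right
    (r.eval (p.eval (csize a) + q.eval (csize a) + csize a + 2))
    (show (l a).length + 1 ≤ p.eval (csize a) + 1 by omega)
  refine ⟨by omega, _, (r1.seq (r2.seq (Run.assign _ _ _))).mono ?_, ?_, fun x hx => ?_⟩
  · simp only [Expr.cost]
    omega
  · simp only [Function.update_self, Expr.eval, e2, List.take_length]
    rfl
  · rw [Function.update_of_ne (by omega), f2 _ (by omega), f1 _ (by omega)]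

@[fun_prop]
theorem list_reverse {l : α → List β} (hl : PolyTime l) : PolyTime (fun a => (l a).reverse) := by
  refine comp (f := List.reverse) ?_ hl
  have h : PolyTime (fun l : List β => l.foldl (fun acc b => b :: acc) []) := by
    refine list_foldl (g := fun _ acc b => b :: acc) (by fun_prop) (by fun_prop) (by fun_prop)
      Polynomial.X fun l l' hl' => ?_
    rw [List.foldl_flip_cons_eq_append']
    simpa [csize_reverse] using hl'.sublist.csize_le
  convert h using 2 with l
  rw [List.foldl_flip_cons_eq_append']
  simp

theorem list_map {l : α → List β} {g : α → β → γ} (hl : PolyTime l)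
    (hg : PolyTime fun x : α × β => g x.1 x.2) : PolyTime (fun a => (l a).map (g a)) := by
  have hfold : ∀ (f : β → γ) (l : List β) (acc : List γ),
      l.foldl (fun acc b => f b :: acc) acc = (l.map f).reverse ++ acc := by
    intro f l
    induction l with
    | nil => simp
    | cons b l ih => intro acc; simp [ih]
  obtain ⟨q, hq⟩ := hg.size_le
  obtain ⟨r, hr⟩ := hl.size_le
  have h : PolyTime (fun a => (l a).foldl (fun acc b => g a b :: acc) []) := by
    refine list_foldl (g := fun a acc b => g a b :: acc) hl (by fun_prop)
      (list_cons (hg.comp (g := fun x : α × List γ × β => (x.1, x.2.2)) (by fun_prop))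
        (by fun_prop))
      (r * (q.comp (Polynomial.X + r + 1) + 1) + 1) fun a l' hl' => ?_
    rw [hfold, List.append_nil, csize_reverse]
    simp only [Polynomial.eval_add, Polynomial.eval_mul, Polynomial.eval_comp, Polynomial.eval_X,
      Polynomial.eval_one]
    refine (csize_le_length_mul (B := q.eval (csize a + r.eval (csize a) + 1)) ?_).trans ?_
    · intro c hc
      obtain ⟨b, hb, rfl⟩ := List.mem_map.1 hc
      refine (hq (a, b)).trans (q.eval_nat_mono ?_)
      have := csize_le_of_mem (hl'.subset hb)
      have := hr a
      simp only [csize_mk]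
      omega
    · rw [List.length_map]
      gcongr
      exact (hl'.length_le.trans (length_le_csize _)).trans (hr a)
  convert h.list_reverse using 2 with a
  simp [hfold]

theorem list_filter {l : α → List β} {c : α → β → Bool} (hl : PolyTime l)
    (hc : PolyTime fun x : α × β => c x.1 x.2) : PolyTime (fun a => (l a).filter (c a)) := by
  have hfold : ∀ (f : β → Bool) (l : List β) (acc : List β),
      l.foldl (fun acc b => bif f b then b :: acc else acc) acc = (l.filter f).reverse ++ acc := by
    intro f l
    induction l with
    | nil => simp
    | cons b l ih => intro acc; cases h : f b <;> simp [ih, h]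
  obtain ⟨r, hr⟩ := hl.size_le
  have h : PolyTime (fun a => (l a).foldl (fun acc b => bif c a b then b :: acc else acc) []) := by
    refine list_foldl (g := fun a acc b => bif c a b then b :: acc else acc) hl (by fun_prop)
      (cond (hc.comp (g := fun x : α × List β × β => (x.1, x.2.2)) (by fun_prop))
        (by fun_prop) (by fun_prop)) r fun a l' hl' => ?_
    rw [hfold, List.append_nil, csize_reverse]
    exact ((List.filter_sublist.trans hl'.sublist).csize_le).trans (hr a)
  convert h.list_reverse using 2 with a
  simp [hfold]

@[fun_prop]
theorem list_isEmpty {l : α → List β} (hl : PolyTime l) : PolyTime (fun a => (l a).isEmpty) :=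
  comp (f := List.isEmpty) (of_isNil fun l => by
    cases l with
    | nil => exact iff_of_true rfl rfl
    | cons => exact iff_of_false nofun nofun) hl

@[fun_prop]
theorem not {f : α → Bool} (hf : PolyTime f) : PolyTime (fun a => !(f a)) := by
  convert cond hf (const false) (const true) using 2 with a
  cases f a <;> rfl

@[fun_prop]
theorem and {f g : α → Bool} (hf : PolyTime f) (hg : PolyTime g) :
    PolyTime (fun a => f a && g a) := by
  convert cond hf hg (const false) using 2 with a
  cases f a <;> rfl

@[fun_prop]
theorem or {f g : α → Bool} (hf : PolyTime f) (hg : PolyTime g) :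
    PolyTime (fun a => f a || g a) := by
  convert cond hf (const true) hg using 2 with a
  cases f a <;> rfl

theorem list_all {l : α → List β} {c : α → β → Bool} (hl : PolyTime l)
    (hc : PolyTime fun x : α × β => c x.1 x.2) : PolyTime (fun a => (l a).all (c a)) := by
  convert (list_filter (c := fun a b => !(c a b)) hl hc.not).list_isEmpty using 2 with a
  rw [Bool.eq_iff_iff]
  simp

theorem list_any {l : α → List β} {c : α → β → Bool} (hl : PolyTime l)
    (hc : PolyTime fun x : α × β => c x.1 x.2) : PolyTime (fun a => (l a).any (c a)) := by
  convert (list_filter hl hc).list_isEmpty.not using 2 with a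
  rw [Bool.eq_iff_iff]
  simp

-- A unary number is a list of `nil`s, so mapping every entry to `nil` already yields the
-- representation of the length.
@[fun_prop]
theorem list_length {l : α → List β} (hl : PolyTime l) : PolyTime (fun a => (l a).length) :=
  of_code_eq (list_map (g := fun _ _ => Data.nil) hl (const Data.nil)) fun a => by
    simp [code]

theorem list_countP {l : α → List β} {c : α → β → Bool} (hl : PolyTime l)
    (hc : PolyTime fun x : α × β => c x.1 x.2) : PolyTime (fun a => (l a).countP (c a)) := by
  simp only [List.countP_eq_length_filter]
  exact (list_filter hl hc).list_length

theorem list_replicate {n : α → ℕ} {b : α → β} (hn : PolyTime n) (hb : PolyTime b) :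
    PolyTime (fun a => List.replicate (n a) (b a)) := by
  have h : PolyTime (fun a => List.replicate (n a) Data.nil) :=
    hn.of_code_eq fun a => by simp [code]
  convert list_map (g := fun a _ => b a) h (hb.comp (g := fun x : α × Data => x.1) (by fun_prop))
    using 2 with a
  simp

/-! #### Unary arithmetic -/

@[fun_prop]
theorem nat_succ {f : α → ℕ} (hf : PolyTime f) : PolyTime (fun a => f a + 1) :=
  of_cons (const Data.nil) hf fun _ => rfl

@[fun_prop]
theorem nat_pred {f : α → ℕ} (hf : PolyTime f) : PolyTime (fun a => f a - 1) :=
  comp (f := fun n => n - 1) (of_tl fun n => by cases n <;> rfl) hf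

@[fun_prop]
theorem nat_add {f g : α → ℕ} (hf : PolyTime f) (hg : PolyTime g) :
    PolyTime (fun a => f a + g a) := by
  obtain ⟨q, hq⟩ := hf.size_le
  obtain ⟨r, hr⟩ := hg.size_le
  have hit : ∀ n m : ℕ, (fun s => s + 1)^[n] m = m + n := fun n m => Nat.succ_iterate m n
  have h := list_foldl (l := fun a => List.replicate (g a) Data.nil) (s := f)
    (g := fun _ s _ => s + 1) (list_replicate hg (const Data.nil)) hf (by fun_prop) (q + r)
    fun a l' hl' => by
      have h1 := hq a
      have h2 := hr a
      have h3 := hl'.length_le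
      simp only [csize_nat, List.length_replicate, List.foldl_const, Polynomial.eval_add,
        hit] at *
      omega
  convert h using 2 with a
  simp only [List.foldl_const, hit, List.length_replicate]

@[fun_prop]
theorem nat_sub {f g : α → ℕ} (hf : PolyTime f) (hg : PolyTime g) :
    PolyTime (fun a => f a - g a) := by
  obtain ⟨q, hq⟩ := hf.size_le
  have hit : ∀ n m : ℕ, (fun s => s - 1)^[n] m = m - n := fun n m => Nat.pred_iterate m n
  have h := list_foldl (l := fun a => List.replicate (g a) Data.nil) (s := f)
    (g := fun _ s _ => s - 1) (list_replicate hg (const Data.nil)) hf (by fun_prop) q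
    fun a l' hl' => by
      have h1 := hq a
      simp only [csize_nat, List.foldl_const, hit] at *
      omega
  convert h using 2 with a
  simp [List.foldl_const, hit]

@[fun_prop]
theorem nat_mul {f g : α → ℕ} (hf : PolyTime f) (hg : PolyTime g) :
    PolyTime (fun a => f a * g a) := by
  obtain ⟨q, hq⟩ := hf.size_le
  obtain ⟨r, hr⟩ := hg.size_le
  have hit : ∀ k n m : ℕ, (fun s => s + k)^[n] m = m + n * k := fun k n m => by
    induction n generalizing m with
    | zero => simp
    | succ n ih => rw [Function.iterate_succ_apply, ih]; ring
  have h := list_foldl (l := fun a => List.replicate (g a) Data.nil) (s := fun _ => 0)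
    (g := fun a s _ => s + f a) (list_replicate hg (const Data.nil)) (by fun_prop)
    (nat_add (by fun_prop) (hf.comp (g := fun x : α × ℕ × Data => x.1) (by fun_prop)))
    (2 * (r * q) + 1)
    fun a l' hl' => by
      have h1 := hq a
      have h2 := hr a
      have h3 := hl'.length_le
      simp only [csize_nat, List.foldl_const, hit, List.length_replicate, zero_add,
        Polynomial.eval_add, Polynomial.eval_mul, Polynomial.eval_one, Polynomial.eval_ofNat] at *
      gcongr <;> omega
  convert h using 2 with a
  simp [List.foldl_const, hit, mul_comm]

@[fun_prop]
theorem nat_pow {f : α → ℕ} (hf : PolyTime f) (n : ℕ) : PolyTime (fun a => f a ^ n) := by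
  induction n with
  | zero => simpa using const 1
  | succ n ih => simpa only [pow_succ] using ih.nat_mul hf

@[fun_prop]
theorem nat_ble {f g : α → ℕ} (hf : PolyTime f) (hg : PolyTime g) :
    PolyTime (fun a => Nat.ble (f a) (g a)) := by
  have h : PolyTime fun n : ℕ => n == 0 := of_isNil fun n => by
    cases n with
    | zero => exact iff_of_true rfl rfl
    | succ n => exact iff_of_false (by simp) nofun
  convert h.comp (nat_sub hf hg) using 2 with a
  rw [Bool.eq_iff_iff]
  simp [Nat.sub_eq_zero_iff_le]

@[fun_prop]
theorem nat_min {f g : α → ℕ} (hf : PolyTime f) (hg : PolyTime g) :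
    PolyTime (fun a => min (f a) (g a)) := by
  convert nat_sub hf (nat_sub hf hg) using 2 with a
  omega

/-! #### Candidates: lists of bits -/

theorem list_headD {l : α → List β} (hl : PolyTime l) (b : β) :
    PolyTime (fun a => (l a).headD b) := by
  refine comp (f := fun l : List β => l.headD b) ?_ hl
  have h := dite (c := fun l : List β => l.isEmpty) (f := fun _ => b)
    (g := fun x => x.1.head (by simpa using x.2)) (by fun_prop) (by fun_prop)
    (list_head (val id) fun x => by simpa using x.2)
  convert h using 2 with l
  cases l <;> rfl

/-- The number `n` is a constant, not part of the input: the recursion is unrolled into a program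
whose length depends on `n`. -/
theorem list_take {l : α → List β} (hl : PolyTime l) (n : ℕ) :
    PolyTime (fun a => (l a).take n) := by
  refine comp (f := fun l : List β => l.take n) ?_ hl
  induction n with
  | zero => simpa using const []
  | succ n ih =>
    have hv : PolyTime (fun x : {l : List β // l.isEmpty = false} => x.1) := val id
    have h := dite (c := fun l : List β => l.isEmpty) (f := fun _ => [])
      (g := fun x => x.1.head (by simpa using x.2) :: x.1.tail.take n) (by fun_prop) (by fun_prop)
      (list_cons (list_head hv fun x => by simpa using x.2) (ih.comp hv.list_tail))
    convert h using 2 with l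
    cases l <;> rfl

@[fun_prop]
theorem bool_beq {f g : α → Bool} (hf : PolyTime f) (hg : PolyTime g) :
    PolyTime (fun a => f a == g a) := by
  convert cond hf hg hg.not using 2 with a
  cases f a <;> cases g a <;> rfl

@[fun_prop]
theorem bits_beq {f g : α → List Bool} (hf : PolyTime f) (hg : PolyTime g) :
    PolyTime (fun a => f a == g a) := by
  obtain ⟨r, hr⟩ := hg.size_le
  -- The state is the unread part of the second list and a flag telling whether all bits so far
  -- agreed. The lists are equal iff at the end nothing is unread and the flag is still set.
  have hfold : ∀ (l m : List Bool) (b : Bool),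
      let x := l.foldl (fun (s : List Bool × Bool) c =>
        (s.1.tail, s.2 && (!s.1.isEmpty && s.1.headD false == c))) (m, b)
      x.1 = m.drop l.length ∧ (x.1.isEmpty && x.2) = (b && l == m) := by
    intro l
    induction l with
    | nil => intro m b; cases m <;> cases b <;> simp
    | cons c l ih =>
      intro m b
      obtain ⟨h1, h2⟩ := ih m.tail (b && (!m.isEmpty && m.headD false == c))
      refine ⟨by simpa using h1, ?_⟩
      simp only [List.foldl_cons] at h2 ⊢
      rw [h2]
      cases m with
      | nil => simp
      | cons d m =>
        rw [Bool.eq_iff_iff]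
        simp
        grind
  have hstep : PolyTime (fun x : α × (List Bool × Bool) × Bool =>
      (x.2.1.1.tail, x.2.1.2 && (!x.2.1.1.isEmpty && x.2.1.1.headD false == x.2.2))) := by
    have := list_headD (l := fun x : α × (List Bool × Bool) × Bool => x.2.1.1) (by fun_prop) false
    fun_prop
  have h := list_foldl (g := fun _ (s : List Bool × Bool) c =>
        (s.1.tail, s.2 && (!s.1.isEmpty && s.1.headD false == c))) (s := fun a => (g a, true))
    hf (by fun_prop) hstep (r + 4) fun a l' hl' => by
      have h1 := (hfold l' (g a) true).1
      have h2 := (List.drop_sublist l'.length (g a)).csize_le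
      have h3 := hr a
      rw [← h1] at h2
      simp only [Polynomial.eval_add, Polynomial.eval_ofNat]
      refine (csize_mk _ _).le.trans ?_
      have h4 := csize_bool_le (l'.foldl (fun (s : List Bool × Bool) c =>
        (s.1.tail, s.2 && (!s.1.isEmpty && s.1.headD false == c))) (g a, true)).2
      omega
  convert h.fst.list_isEmpty.and h.snd using 2 with a
  rw [(hfold (f a) (g a) true).2]
  simp

@[fun_prop]
theorem bits_contains {l : α → List (List Bool)} {c : α → List Bool} (hl : PolyTime l)
    (hc : PolyTime c) : PolyTime (fun a => (l a).contains (c a)) := by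
  simp only [List.contains_eq_any_beq]
  exact list_any (c := fun a b => c a == b) hl
    (bits_beq (hc.comp (g := fun x : α × List Bool => x.1) (by fun_prop)) (by fun_prop))

end PolyTime

/-! ### The algorithm -/

section Lists

variable {ι : Type} [BEq ι]

/-- The number of lists in `X` that contain `c`. -/
def load (X : List (List ι)) (c : ι) : ℕ := X.countP fun v => v.contains c

/-- All elements of `x` are elements of `y`. -/
def contained (x y : List ι) : Bool := x.all fun c => y.contains c

/-- `x` and `y` have the same elements. -/
def sameSet (x y : List ι) : Bool := contained x y && contained y x

/-- The number of lists in `K` that contain all elements of `A`. -/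
def degree (K : List (List ι)) (A : List ι) : ℕ := K.countP fun u => contained A u

/-- Does some set that consists of the `j` elements of `A` and of elements of `v` (of which the
first `n` are looked at) have the largest degree allowed? -/
def saturated (d : ℕ) : ℕ → ℕ → ℕ → List (List ι) → List ι → List ι → Bool
  | 0, j, B, K, A, _ => Nat.ble (B ^ (d - j)) (degree K A)
  | _ + 1, j, B, K, A, [] => Nat.ble (B ^ (d - j)) (degree K A)
  | n + 1, j, B, K, A, c :: v => saturated d n (j + 1) B K (c :: A) v || saturated d n j B K A v

/-- Keep, of the lists in `H`, only those without a saturated subset at the time they come up. -/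
def kernel (d B : ℕ) (H : List (List ι)) : List (List ι) :=
  H.foldl (fun K v => bif saturated d d 0 B K [] v then K else v :: K) []

end Lists

/-- The successor of a word `w` whose letters are stored as the nonempty suffixes of a list `K`,
the least significant letter first, and whether there was an overflow. -/
def advance {β : Type} (K : List β) : List (List β) → Bool × List (List β)
  | [] => (true, [])
  | s :: w =>
    bif s.tail.isEmpty then ((advance K w).1, K :: (advance K w).2) else (false, s.tail :: w)

namespace AVInstance

/-- The names of the candidates. -/
def cands (I : AVInstance) : List (List Bool) := (List.range I.m).map Nat.bits

/-- The name of the distinguished candidate. -/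
def distinguished (I : AVInstance) : List Bool := (I.p : ℕ).bits

/-- A vote as a list of names. -/
def ballot {m : ℕ} (v : Vote m) : List (List Bool) :=
  (List.finRange m).map fun i => (v i : ℕ).bits

/-- The score that `c` gets from the registered votes. -/
def base (r : ℕ) (I : AVInstance) (c : List Bool) : ℕ :=
  load ((I.registered.map ballot).map (List.take r)) c

/-- The unregistered votes approving the distinguished candidate, each as the list of the other
candidates it approves. -/
def pool (r : ℕ) (I : AVInstance) : List (List (List Bool)) :=
  (((I.unregistered.map ballot).map (List.take r)).filter
    fun v => v.contains I.distinguished).map fun v => v.filter fun c => !(c == I.distinguished)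

/-- The number of votes to be added. -/
def added (r : ℕ) (I : AVInstance) : ℕ := min I.R (I.pool r).length

/-- The final score of the distinguished candidate. -/
def target (r : ℕ) (I : AVInstance) : ℕ := I.base r I.distinguished + I.added r

/-- The votes of the pool that do not, just by themselves, spoil the victory. -/
def usable (r : ℕ) (I : AVInstance) : List (List (List Bool)) :=
  (I.pool r).filter fun v => v.all fun c => Nat.ble (I.base r c + 2) (I.target r)

/-- The few votes among which it suffices to look for a solution. -/
def letters (r : ℕ) (I : AVInstance) : List (List (List Bool)) :=
  kernel (r - 1) (r * I.R) (I.usable r)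

/-- Does `X` consist of votes of the pool, and does adding them make the distinguished candidate
the unique winner? -/
def accepts (r : ℕ) (I : AVInstance) (X : List (List (List Bool))) : Bool :=
  (X.all fun x => Nat.ble (X.countP (sameSet x)) ((I.pool r).countP (sameSet x))) &&
    I.cands.all fun c => c == I.distinguished ||
      Nat.ble (I.base r c + load X c + 1) (I.target r)

/-- The states of the exhaustive search: whether to go on, the answer so far, the instance, and
the current word. -/
abbrev SearchState : Type := Bool × Bool × AVInstance × List (List (List (List Bool)))

/-- One step of the exhaustive search. -/
def searchStep (r : ℕ) (x : SearchState) : SearchState :=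
  (!(advance (x.2.2.1.letters r) x.2.2.2).1,
    x.2.1 || x.2.2.1.accepts r (x.2.2.2.map fun s => s.headD []),
    x.2.2.1, (advance (x.2.2.1.letters r) x.2.2.2).2)

/-- The initial state of the exhaustive search. -/
def searchStart (r : ℕ) (I : AVInstance) : SearchState :=
  (true, false, I, List.replicate (I.added r) (I.letters r))

end AVInstance

/-! ### The parts of the algorithm run in polynomial time -/

namespace PolyTime

variable {α β : Type} [Coded α] [Coded β]

@[fun_prop]
theorem load {X : α → List (List (List Bool))} {c : α → List Bool} (hX : PolyTime X)
    (hc : PolyTime c) : PolyTime (fun a => load (X a) (c a)) := by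
  unfold _root_.load
  exact list_countP (c := fun a v => v.contains (c a)) hX
    (bits_contains (by fun_prop) (hc.comp (fst id)))

@[fun_prop]
theorem contained {x y : α → List (List Bool)} (hx : PolyTime x)
    (hy : PolyTime y) : PolyTime (fun a => contained (x a) (y a)) :=
  list_all (c := fun a c => (y a).contains c) hx
    (bits_contains (hy.comp (fst id)) (by fun_prop))

@[fun_prop]
theorem sameSet {x y : α → List (List Bool)} (hx : PolyTime x)
    (hy : PolyTime y) : PolyTime (fun a => sameSet (x a) (y a)) :=
  (hx.contained hy).and (hy.contained hx)

@[fun_prop]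
theorem degree {K : α → List (List (List Bool))} {A : α → List (List Bool)} (hK : PolyTime K)
    (hA : PolyTime A) : PolyTime (fun a => degree (K a) (A a)) :=
  list_countP (c := fun a u => _root_.contained (A a) u) hK
    (contained (hA.comp (fst id)) (by fun_prop))

/-- The data on which the test for a saturated subset depends: the degree bound, the lists kept so
far, the chosen elements, and the remaining ones. -/
abbrev SaturatedArgs : Type :=
  ℕ × List (List (List Bool)) × List (List Bool) × List (List Bool)

/-- The depth `n` is constant, so the induction unrolls the branching recursion into a fixed
program; its up to 2^n branches are a constant factor for fixed r. -/
theorem saturated (d n j : ℕ) {B : α → ℕ} {K : α → List (List (List Bool))}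
    {A v : α → List (List Bool)} (hB : PolyTime B) (hK : PolyTime K) (hA : PolyTime A)
    (hv : PolyTime v) : PolyTime (fun a => saturated d n j (B a) (K a) (A a) (v a)) := by
  suffices h : PolyTime (fun x : SaturatedArgs => _root_.saturated d n j x.1 x.2.1 x.2.2.1 x.2.2.2) from
    h.comp (hB.mk (hK.mk (hA.mk hv)))
  clear hB hK hA hv
  induction n generalizing j with
  | zero => simp only [_root_.saturated]; fun_prop
  | succ n ih =>
    have key (j : ℕ) {γ : Type} [Coded γ] {B : γ → ℕ} {K : γ → List (List (List Bool))}
        {A v : γ → List (List Bool)} (hB : PolyTime B) (hK : PolyTime K) (hA : PolyTime A)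
        (hv : PolyTime v) : PolyTime (fun a => _root_.saturated d n j (B a) (K a) (A a) (v a)) :=
      (ih j).comp (hB.mk (hK.mk (hA.mk hv)))
    have hval : PolyTime (fun x : {x : SaturatedArgs // x.2.2.2.isEmpty = false} => x.1) := val id
    have hhead : PolyTime (fun x : {x : SaturatedArgs // x.2.2.2.isEmpty = false} =>
        x.1.2.2.2.head (by simpa using x.2)) :=
      list_head (l := fun x : {x : SaturatedArgs // x.2.2.2.isEmpty = false} => x.1.2.2.2)
        (by fun_prop) fun x => by simpa using x.2
    have h := dite (c := fun x : SaturatedArgs => x.2.2.2.isEmpty)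
      (f := fun x => Nat.ble (x.1.1 ^ (d - j)) (_root_.degree x.1.2.1 x.1.2.2.1))
      (g := fun x => _root_.saturated d n (j + 1) x.1.1 x.1.2.1
          (x.1.2.2.2.head (by simpa using x.2) :: x.1.2.2.1) x.1.2.2.2.tail ||
        _root_.saturated d n j x.1.1 x.1.2.1 x.1.2.2.1 x.1.2.2.2.tail) (by fun_prop)
      (by
        have hval : PolyTime (fun x : {x : SaturatedArgs // x.2.2.2.isEmpty = true} => x.1) := val id
        fun_prop)
      (or (key (j + 1) hval.fst hval.snd.fst (hhead.list_cons hval.snd.snd.fst)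
          hval.snd.snd.snd.list_tail)
        (key j hval.fst hval.snd.fst hval.snd.snd.fst hval.snd.snd.snd.list_tail))
    convert h using 2 with x
    obtain ⟨B, K, A, _ | ⟨c, v⟩⟩ := x <;> rfl

end PolyTime

theorem kernel_foldl_sublist {ι : Type} [BEq ι] (d B : ℕ) (H K : List (List ι)) :
    (H.foldl (fun K v => bif saturated d d 0 B K [] v then K else v :: K) K).Sublist
      (H.reverse ++ K) := by
  induction H generalizing K with
  | nil => simp
  | cons v H ih =>
    refine (ih _).trans ?_
    rw [List.reverse_cons, List.append_assoc]
    refine List.Sublist.append_left ?_ _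
    cases h : saturated d d 0 B K [] v <;> simp [h]

theorem kernel_sublist {ι : Type} [BEq ι] (d B : ℕ) (H : List (List ι)) :
    (kernel d B H).Sublist H.reverse := by
  simpa [kernel] using kernel_foldl_sublist d B H []

namespace PolyTime

variable {α β : Type} [Coded α] [Coded β]

@[fun_prop]
theorem kernel (d : ℕ) {B : α → ℕ} {H : α → List (List (List Bool))} (hB : PolyTime B)
    (hH : PolyTime H) : PolyTime (fun a => kernel d (B a) (H a)) := by
  obtain ⟨q, hq⟩ := hH.size_le
  refine list_foldl
    (g := fun a K v => bif _root_.saturated d d 0 (B a) K [] v then K else v :: K) hH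
    (by fun_prop) (cond (saturated d d 0 (hB.comp (by fun_prop)) (by fun_prop) (by fun_prop)
      (by fun_prop)) (by fun_prop) (by fun_prop)) q fun a l' hl' => ?_
  refine ((kernel_sublist d (B a) l').csize_le.trans ?_).trans (hq a)
  rw [csize_reverse]
  exact hl'.sublist.csize_le

end PolyTime

/-- The recursion as a left fold, which `list_foldl` can run: `o` is the pending carry, and `acc`
holds the letters already treated, in reverse order. -/
theorem advance_eq_foldl {β : Type} (K : List β) (w acc : List (List β)) (o : Bool) :
    let x := w.foldl (fun (y : Bool × List (List β)) s => bif y.1 then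
      (bif s.tail.isEmpty then (true, K :: y.2) else (false, s.tail :: y.2))
        else (false, s :: y.2)) (o, acc)
    (x.1, x.2.reverse) =
      bif o then ((advance K w).1, acc.reverse ++ (advance K w).2) else (false, acc.reverse ++ w) := by
  induction w generalizing acc o with
  | nil => cases o <;> simp [advance]
  | cons s w ih =>
    cases o <;> cases h : s.tail.isEmpty <;> simp [advance, h] at ih ⊢ <;> simp [ih]

theorem length_advance {β : Type} (K : List β) (w : List (List β)) :
    (advance K w).2.length = w.length := by
  induction w with
  | nil => rfl
  | cons s w ih => cases h : s.tail.isEmpty <;> simp [advance, h, ih]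

namespace PolyTime

variable {α β : Type} [Coded α] [Coded β]

@[fun_prop]
theorem advance {K : α → List β} {w : α → List (List β)} (hK : PolyTime K) (hw : PolyTime w) :
    PolyTime (fun a => advance (K a) (w a)) := by
  obtain ⟨q, hq⟩ := hK.size_le
  obtain ⟨r, hr⟩ := hw.size_le
  let g : List β → Bool × List (List β) → List β → Bool × List (List β) :=
    fun K y s => bif y.1 then
      (bif s.tail.isEmpty then (true, K :: y.2) else (false, s.tail :: y.2)) else (false, s :: y.2)
  have hg : PolyTime (fun x : α × (Bool × List (List β)) × List β => g (K x.1) x.2.1 x.2.2) := by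
    have hK' : PolyTime (fun x : α × (Bool × List (List β)) × List β => K x.1) :=
      hK.comp (fst id)
    exact cond (by fun_prop) (cond (by fun_prop) (mk (const true) (list_cons hK' (by fun_prop)))
      (by fun_prop)) (by fun_prop)
  -- A step pushes either part of the letter it reads or one copy of `K`, so the accumulator grows
  -- additively.
  have hsize : ∀ (K : List β) (l : List (List β)) (y : Bool × List (List β)),
      csize (l.foldl (g K) y) ≤ csize y + csize l + l.length * (csize K + 5) := by
    intro K l
    induction l with
    | nil => simp
    | cons s l ih =>
      intro y
      have h1 := ih (g K y s)
      have h2 : csize (g K y s) ≤ csize y + csize s + csize K + 5 := by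
        have h3 := (List.tail_sublist s).csize_le
        obtain ⟨o, y⟩ := y
        have h4 := csize_bool_le o
        have h5 := csize_bool_le true
        have h6 := csize_bool_le false
        have h7 := one_le_csize o
        cases o <;> cases h : s.tail.isEmpty <;> simp [g, h] <;> omega
      simp only [List.foldl_cons, List.length_cons, csize_cons, Nat.add_mul, one_mul]
      omega
  have h := list_foldl (g := fun a => g (K a)) (s := fun _ => (true, [])) hw (by fun_prop) hg
    (5 + r + r * (q + 5)) fun a l' hl' => by
      refine (hsize _ _ _).trans ?_
      simp only [Polynomial.eval_add, Polynomial.eval_mul, Polynomial.eval_ofNat]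
      have h1 := hl'.sublist.csize_le
      have h2 := length_le_csize l'
      have h3 := hr a
      gcongr
      · exact le_rfl
      · omega
      · omega
      · exact hq a
  convert h.fst.mk h.snd.list_reverse using 2 with a
  have := advance_eq_foldl (K a) (w a) [] true
  simpa using this.symm

end PolyTime

/-- The number with the given bits, the least significant one first. -/
def ofBits (l : List Bool) : ℕ := l.foldr (fun b n => bif b then 2 * n + 1 else 2 * n) 0

theorem ofBits_bits (n : ℕ) : ofBits n.bits = n := by
  induction n using Nat.binaryRec' with
  | zero => simp [ofBits]
  | bit b n h ih =>
    rw [Nat.bits_append_bit _ _ h]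
    simp only [ofBits, List.foldr_cons] at ih ⊢
    rw [ih]
    cases b <;> simp [Nat.bit]

/-- Passing to a suffix drops low-order bits, which amounts to dividing by a power of two. -/
theorem ofBits_suffix_le {l l' : List Bool} (h : l' <:+ l) : ofBits l' ≤ ofBits l := by
  obtain ⟨t, rfl⟩ := h
  induction t with
  | nil => rfl
  | cons b t ih =>
    refine ih.trans ?_
    simp only [ofBits, List.cons_append, List.foldr_cons]
    cases b <;> simp <;> omega

/-! ### Reading the fields of an encoded instance -/

namespace AVInstance

theorem code_eq (I : AVInstance) : code I = Data.ofList [code I.cands, code I.distinguished,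
    code (I.registered.map ballot), code (I.unregistered.map ballot), code I.R.bits] := by
  have h : ∀ {m : ℕ} (l : List (Vote m)), code (l.map ballot) =
      Data.ofList (l.map encodeVote) := by
    intro m l
    simp only [code, List.map_map]
    congr 1
    refine List.map_congr_left fun v _ => ?_
    simp only [Function.comp, ballot, encodeVote, List.map_map]
    rfl
  rw [h, h]
  simp only [code, encode, cands, List.map_map]
  rfl

end AVInstance

/-- Here R ≤ |Π_T| is essential: R is written in binary, yet it is bounded by the input size and may
therefore be expanded to unary. -/
theorem AVInstance.R_le_csize (I : AVInstance) : I.R ≤ csize I := by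
  have h1 := I.R_le
  have h2 := length_le_csize (I.unregistered.map ballot)
  have h3 : csize (I.unregistered.map ballot) ≤ csize I := by
    simp only [csize, I.code_eq, Data.ofList, Data.size]
    omega
  simp only [List.length_map] at h2
  omega

namespace PolyTime

variable {α : Type} [Coded α]

/-- The trailing empty list closes the nested pairs, so that the tuple has literally the same
representation as the instance and projections give the fields. -/
theorem instance_fields : PolyTime (fun I : AVInstance => (I.cands, I.distinguished,
    I.registered.map AVInstance.ballot, I.unregistered.map AVInstance.ballot, I.R.bits,
      ([] : List Data))) :=
  of_code_eq_input fun I => by rw [I.code_eq]; rfl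

@[fun_prop]
theorem cands {f : α → AVInstance} (hf : PolyTime f) : PolyTime (fun a => (f a).cands) :=
  (instance_fields.comp hf).fst

@[fun_prop]
theorem distinguished {f : α → AVInstance} (hf : PolyTime f) :
    PolyTime (fun a => (f a).distinguished) :=
  (instance_fields.comp hf).snd.fst

@[fun_prop]
theorem registered_ballots {f : α → AVInstance} (hf : PolyTime f) :
    PolyTime (fun a => (f a).registered.map AVInstance.ballot) :=
  (instance_fields.comp hf).snd.snd.fst

@[fun_prop]
theorem unregistered_ballots {f : α → AVInstance} (hf : PolyTime f) :
    PolyTime (fun a => (f a).unregistered.map AVInstance.ballot) :=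
  (instance_fields.comp hf).snd.snd.snd.fst

/-- Turning the bound on the number of added votes from binary into unary. -/
@[fun_prop]
theorem budget {f : α → AVInstance} (hf : PolyTime f) : PolyTime (fun a => (f a).R) := by
  refine comp (f := AVInstance.R) ?_ hf
  -- Horner's scheme from the most significant bit. A prefix of the reversed bits is a reversed
  -- suffix of the bits, so no intermediate value exceeds R.
  have h := list_foldl (l := fun I : AVInstance => I.R.bits.reverse) (s := fun _ => 0)
    (g := fun _ n b => bif b then 2 * n + 1 else 2 * n)
    instance_fields.snd.snd.snd.snd.fst.list_reverse (by fun_prop) (by fun_prop)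
    (2 * Polynomial.X + 1) fun I l' hl' => by
      rw [← l'.reverse_reverse, List.foldl_reverse]
      have h1 := ofBits_suffix_le (l := I.R.bits) (l' := l'.reverse)
        (by rw [← I.R.bits.reverse_reverse]; exact List.reverse_suffix.2 hl')
      rw [ofBits_bits] at h1
      have h2 := I.R_le_csize
      have h3 := h1.trans h2
      simp only [ofBits, csize_nat, Polynomial.eval_add, Polynomial.eval_mul, Polynomial.eval_X,
        Polynomial.eval_one, Polynomial.eval_ofNat] at h3 ⊢
      omega
  convert h using 2 with I
  rw [List.foldl_reverse]
  exact (ofBits_bits I.R).symm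

@[fun_prop]
theorem base (r : ℕ) {f : α → AVInstance} {c : α → List Bool} (hf : PolyTime f)
    (hc : PolyTime c) : PolyTime (fun a => (f a).base r (c a)) := by
  unfold AVInstance.base
  exact load (list_map (registered_ballots hf) (list_take (snd id) r)) hc

@[fun_prop]
theorem pool (r : ℕ) {f : α → AVInstance} (hf : PolyTime f) :
    PolyTime (fun a => (f a).pool r) := by
  refine comp (f := AVInstance.pool r) ?_ hf
  exact list_map (g := fun I v => v.filter fun c => !(c == I.distinguished))
    (list_filter (c := fun I v => v.contains I.distinguished)
      (list_map (g := fun _ v => v.take r) (unregistered_ballots id) (list_take (snd id) r))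
      (by fun_prop))
    (list_filter (c := fun (x : AVInstance × List (List Bool)) c => !(c == x.1.distinguished))
      (by fun_prop) (by fun_prop))

@[fun_prop]
theorem added (r : ℕ) {f : α → AVInstance} (hf : PolyTime f) :
    PolyTime (fun a => (f a).added r) := by
  unfold AVInstance.added
  fun_prop

@[fun_prop]
theorem target (r : ℕ) {f : α → AVInstance} (hf : PolyTime f) :
    PolyTime (fun a => (f a).target r) := by
  unfold AVInstance.target
  fun_prop

@[fun_prop]
theorem usable (r : ℕ) {f : α → AVInstance} (hf : PolyTime f) :
    PolyTime (fun a => (f a).usable r) := by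
  refine comp (f := AVInstance.usable r) ?_ hf
  exact list_filter (c := fun (I : AVInstance) (v : List (List Bool)) =>
      v.all fun c => Nat.ble (I.base r c + 2) (I.target r))
    (by fun_prop) (list_all (c := fun (x : AVInstance × List (List Bool)) c =>
      Nat.ble (x.1.base r c + 2) (x.1.target r)) (by fun_prop) (by fun_prop))

@[fun_prop]
theorem letters (r : ℕ) {f : α → AVInstance} (hf : PolyTime f) :
    PolyTime (fun a => (f a).letters r) := by
  unfold AVInstance.letters
  fun_prop

@[fun_prop]
theorem accepts (r : ℕ) {f : α → AVInstance} {X : α → List (List (List Bool))} (hf : PolyTime f)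
    (hX : PolyTime X) : PolyTime (fun a => (f a).accepts r (X a)) := by
  refine comp (f := fun x : AVInstance × List (List (List Bool)) => x.1.accepts r x.2) ?_
    (hf.mk hX)
  refine and (list_all (c := fun (x : AVInstance × List (List (List Bool))) y =>
      Nat.ble (x.2.countP (_root_.sameSet y)) ((x.1.pool r).countP (_root_.sameSet y)))
      (by fun_prop) (nat_ble (list_countP (by fun_prop) (by fun_prop))
        (list_countP (by fun_prop) (by fun_prop))))
    (list_all (c := fun (x : AVInstance × List (List (List Bool))) c =>
      c == x.1.distinguished || Nat.ble (x.1.base r c + _root_.load x.2 c + 1) (x.1.target r))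
      (by fun_prop) (by fun_prop))

theorem searchStart (r : ℕ) : PolyTime (AVInstance.searchStart r) :=
  mk (by fun_prop) (mk (by fun_prop) (mk (by fun_prop) (list_replicate (by fun_prop)
    (by fun_prop))))

theorem searchStep (r : ℕ) : PolyTime (AVInstance.searchStep r) := by
  have h : PolyTime (fun x : AVInstance.SearchState => x.2.2.2.map fun s => s.headD []) :=
    list_map (g := fun (_ : AVInstance.SearchState) (s : List (List (List Bool))) =>
      s.headD []) (by fun_prop)
      (list_headD (by fun_prop) _)
  have h' := advance (K := fun x : AVInstance.SearchState => x.2.2.1.letters r)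
    (w := fun x => x.2.2.2) (by fun_prop) (by fun_prop)
  exact mk h'.fst.not (mk (or (by fun_prop) (accepts r (by fun_prop) h))
    (mk (by fun_prop) h'.snd))

end PolyTime

/-! ### The exhaustive search -/

section Words

variable {β : Type} {K : List β} {w w' : List (List β)}

/-- The words over `K`: every letter is represented by a suffix of `K`, which is nonempty unless
`K` is empty. -/
def IsWord (K : List β) (w : List (List β)) : Prop := ∀ s ∈ w, s <:+ K ∧ (s = [] → K = [])

/-- The number of words that come after `w`. -/
def rank (n : ℕ) : List (List β) → ℕ
  | [] => 0
  | s :: w => s.length - 1 + n * rank n w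

theorem IsWord.of_cons {s : List β} (h : IsWord K (s :: w)) : IsWord K w :=
  fun t ht => h t (List.mem_cons_of_mem _ ht)

theorem isWord_replicate (K : List β) (k : ℕ) : IsWord K (List.replicate k K) := by
  intro s hs
  rw [List.eq_of_mem_replicate hs]
  exact ⟨List.suffix_rfl, fun h => h⟩

theorem isWord_advance (h : IsWord K w) : IsWord K (advance K w).2 := by
  induction w with
  | nil => simpa [advance] using h
  | cons s w ih =>
    have ih := ih h.of_cons
    have hs := h s List.mem_cons_self
    cases ht : s.tail.isEmpty
    · simp only [advance, ht, cond_false]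
      intro t hmem
      rcases List.mem_cons.1 hmem with rfl | hmem
      · exact ⟨(List.tail_suffix s).trans hs.1, fun h0 => by simp [h0] at ht⟩
      · exact h.of_cons t hmem
    · simp only [advance, ht, cond_true]
      intro t hmem
      rcases List.mem_cons.1 hmem with rfl | hmem
      · exact ⟨List.suffix_rfl, fun h => h⟩
      · exact ih t hmem

theorem rank_zero (h : IsWord ([] : List β) w) (n : ℕ) : rank n w = 0 := by
  induction w with
  | nil => rfl
  | cons s w ih =>
    have hs := List.suffix_nil.1 (h s List.mem_cons_self).1
    simp [rank, hs, ih h.of_cons]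

/-- A word is a number in base `K.length` with digits `s.length - 1`. Shortening a suffix lowers a
digit by one, resetting an exhausted suffix to `K` is a borrow, and overflow means that all digits
are zero. -/
theorem rank_advance (h : IsWord K w) :
    bif (advance K w).1 then rank K.length w = 0
      else rank K.length (advance K w).2 + 1 = rank K.length w := by
  induction w with
  | nil => simp [advance, rank]
  | cons s w ih =>
    have ih := ih h.of_cons
    cases ht : s.tail.isEmpty
    · have : 2 ≤ s.length := by
        rcases s with _ | ⟨a, _ | ⟨b, s⟩⟩ <;> simp at ht ⊢
      simp only [advance, ht, cond_false, rank, List.length_tail]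
      omega
    · have hs : s.length - 1 = 0 := by
        rw [← List.length_tail, List.isEmpty_iff.1 ht]; rfl
      simp only [advance, ht, cond_true]
      cases ho : (advance K w).1
      · simp only [ho, cond_false] at ih ⊢
        simp only [rank, hs, ← ih]
        rcases K with _ | ⟨a, K⟩
        · rw [rank_zero h.of_cons] at ih; omega
        · simp only [List.length_cons]
          ring_nf
          omega
      · simp only [ho, cond_true] at ih ⊢
        simp [rank, hs, ih]

theorem rank_lt (hK : K ≠ []) (h : IsWord K w) : rank K.length w < K.length ^ w.length := by
  induction w with
  | nil => simp [rank]
  | cons s w ih =>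
    have ih := ih h.of_cons
    have h1 := (h s List.mem_cons_self).1.length_le
    have h2 := List.length_pos_iff.2 hK
    simp only [rank, List.length_cons, pow_succ']
    calc s.length - 1 + K.length * rank K.length w
        < K.length * (rank K.length w + 1) := by rw [mul_add_one]; omega
      _ ≤ _ := Nat.mul_le_mul_left _ ih

/-- All digits are maximal here, so a countdown from this word meets every word of length `k`. -/
theorem rank_replicate (hK : K ≠ []) (k : ℕ) :
    rank K.length (List.replicate k K) + 1 = K.length ^ k := by
  induction k with
  | zero => simp [rank]
  | succ k ih =>
    have h2 := List.length_pos_iff.2 hK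
    rw [pow_succ', ← ih, List.replicate_succ, rank, mul_add_one]
    omega

/-- Remainder and quotient modulo `K.length` recover the digits, and a suffix of `K` is determined
by its length. -/
theorem rank_injective (h : IsWord K w) (h' : IsWord K w') (hl : w.length = w'.length)
    (hr : rank K.length w = rank K.length w') : w = w' := by
  induction w generalizing w' with
  | nil => exact (List.length_eq_zero_iff.1 hl.symm).symm
  | cons s w ih =>
    rcases w' with _ | ⟨s', w'⟩
    · simp at hl
    have hs := h s List.mem_cons_self
    have hs' := h' s' List.mem_cons_self
    have key : s.length = s'.length ∧ rank K.length w = rank K.length w' := by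
      rcases List.eq_nil_or_concat K with rfl | ⟨_, _, hK⟩
      · rw [rank_zero h.of_cons, rank_zero h'.of_cons, List.suffix_nil.1 hs.1,
          List.suffix_nil.1 hs'.1]
        exact ⟨rfl, rfl⟩
      · have hK : K ≠ [] := by simp [hK]
        have h2 := List.length_pos_iff.2 hK
        have h3 := List.length_pos_iff.2 fun h0 => hK (hs.2 h0)
        have h4 := List.length_pos_iff.2 fun h0 => hK (hs'.2 h0)
        have h5 := hs.1.length_le
        have h6 := hs'.1.length_le
        simp only [rank] at hr
        have h7 := congrArg (· % K.length) hr
        have h8 := congrArg (· / K.length) hr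
        simp only [Nat.add_mul_mod_self_left, Nat.add_mul_div_left _ _ h2] at h7 h8
        rw [Nat.mod_eq_of_lt (by omega), Nat.mod_eq_of_lt (by omega)] at h7
        rw [Nat.div_eq_of_lt (by omega), Nat.div_eq_of_lt (by omega)] at h8
        omega
    rw [ih h.of_cons h'.of_cons (by simpa using hl) key.2]
    congr 1
    exact (List.suffix_of_suffix_length_le hs.1 hs'.1 key.1.le).eq_of_length key.1

theorem exists_word (b : β) {X : List β} (hX : ∀ x ∈ X, x ∈ K) :
    ∃ w, IsWord K w ∧ w.map (fun s => s.headD b) = X := by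
  induction X with
  | nil => exact ⟨[], by simp [IsWord], rfl⟩
  | cons x X ih =>
    obtain ⟨w, hw, rfl⟩ := ih fun y hy => hX y (List.mem_cons_of_mem _ hy)
    obtain ⟨l, l', h⟩ := List.append_of_mem (hX x List.mem_cons_self)
    refine ⟨(x :: l') :: w, ?_, rfl⟩
    intro s hs
    rcases List.mem_cons.1 hs with rfl | hs
    · exact ⟨⟨l, h.symm⟩, nofun⟩
    · exact hw s hs

end Words

namespace AVInstance

/-- The word represented by a list of suffixes. -/
def heads (w : List (List (List (List Bool)))) : List (List (List Bool)) :=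
  w.map fun s => s.headD []

theorem searchStep_mk (r : ℕ) (o b : Bool) (I : AVInstance) (w : List (List (List (List Bool)))) :
    searchStep r (o, b, I, w) = (!(advance (I.letters r) w).1, b || I.accepts r (heads w), I,
      (advance (I.letters r) w).2) := rfl

/-- This bounds the size of the states: the word keeps its length and its letters remain suffixes of
`letters`. -/
theorem search_invariant (r : ℕ) (I : AVInstance) {w : List (List (List (List Bool)))}
    (hw : IsWord (I.letters r) w) (o b : Bool) (i : ℕ) :
    ∃ o' b' w', (searchStep r)^[i] (o, b, I, w) = (o', b', I, w') ∧ IsWord (I.letters r) w' ∧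
      w'.length = w.length := by
  induction i generalizing o b w with
  | zero => exact ⟨o, b, w, rfl, hw, rfl⟩
  | succ i ih =>
    rw [Function.iterate_succ_apply, searchStep_mk]
    obtain ⟨o', b', w', h1, h2, h3⟩ := ih (isWord_advance hw) (!(advance (I.letters r) w).1)
      (b || I.accepts r (heads w))
    exact ⟨o', b', w', h1, h2, h3.trans (length_advance _ _)⟩

/-- Each step tests the current word and then lowers the rank by one. By injectivity of the rank,
any other word of rank at most the current one comes later. Soundness needs no reference to the
letters, because `accepts` itself checks membership in the pool. -/
theorem search_result (r : ℕ) (I : AVInstance) {w : List (List (List (List Bool)))}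
    (hw : IsWord (I.letters r) w) (b : Bool) {N : ℕ}
    (hN : N = rank (I.letters r).length w + 1) :
    (∀ i < N, ((searchStep r)^[i] (true, b, I, w)).1 = true) ∧
      ((searchStep r)^[N] (true, b, I, w)).1 = false ∧
      (((searchStep r)^[N] (true, b, I, w)).2.1 = true →
        b = true ∨ ∃ X, X.length = w.length ∧ I.accepts r X = true) ∧
      ((b = true ∨ ∃ w', IsWord (I.letters r) w' ∧ w'.length = w.length ∧
        rank (I.letters r).length w' ≤ rank (I.letters r).length w ∧
          I.accepts r (heads w') = true) →
        ((searchStep r)^[N] (true, b, I, w)).2.1 = true) := by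
  induction N generalizing w b with
  | zero => omega
  | succ N ih =>
    simp only [Function.iterate_succ_apply, searchStep_mk]
    have hlen : (heads w).length = w.length := by simp [heads]
    have hadv := rank_advance hw
    cases ho : (advance (I.letters r) w).1
    · simp only [ho, cond_false] at hadv
      obtain ⟨h1, h2, h3, h4⟩ := ih (isWord_advance hw) (b || I.accepts r (heads w)) (by omega)
      rw [length_advance] at h3 h4
      simp only [Bool.not_false]
      refine ⟨fun i hi => ?_, h2, fun h => ?_, fun h => h4 ?_⟩
      · rcases i with _ | i
        · rfl
        · rw [Function.iterate_succ_apply, searchStep_mk, ho]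
          exact h1 i (by omega)
      · rcases h3 h with h | h
        · rcases Bool.or_eq_true_iff.1 h with h | h
          · exact .inl h
          · exact .inr ⟨_, hlen, h⟩
        · exact .inr h
      · rcases h with h | ⟨w', hw', hl, hr, ha⟩
        · exact .inl (by simp [h])
        · by_cases hww : w' = w
          · subst hww
            exact .inl (by simp [ha])
          · refine .inr ⟨w', hw', hl, ?_, ha⟩
            have : rank (I.letters r).length w' ≠ rank (I.letters r).length w := fun h =>
              hww (rank_injective hw' hw hl h)
            omega
    · simp only [ho, cond_true] at hadv
      obtain rfl : N = 0 := by omega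
      simp only [Bool.not_true, Function.iterate_zero, id]
      refine ⟨fun i hi => ?_, trivial, fun h => ?_, fun h => ?_⟩
      · obtain rfl : i = 0 := by omega
        rfl
      · rcases Bool.or_eq_true_iff.1 h with h | h
        · exact .inl h
        · exact .inr ⟨_, hlen, h⟩
      · rcases h with h | ⟨w', hw', hl, hr, ha⟩
        · simp [h]
        · obtain rfl : w' = w := rank_injective hw' hw hl (by omega)
          simp [ha]

/-- The exhaustive search as a program. -/
theorem exists_search_program (r : ℕ) : ∃ (P : Cmd) (q : Polynomial ℕ), ∀ I : AVInstance,
    ∃ (t : ℕ) (s : Store), Exec P (inputStore I.encode) t s ∧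
      t ≤ max 1 ((I.letters r).length ^ I.added r) * q.eval I.encode.size ∧
      (s 0 ≠ Data.nil → ∃ X, X.length = I.added r ∧ I.accepts r X = true) ∧
      ((∃ X, X.length = I.added r ∧ (∀ x ∈ X, x ∈ I.letters r) ∧ I.accepts r X = true) →
        s 0 ≠ Data.nil) := by
  have hc : ∀ x : SearchState, (code x).hd ≠ Data.nil ↔ x.1 = true := by
    rintro ⟨_ | _, x⟩
    · exact iff_of_false (fun h => h rfl) nofun
    · exact iff_of_true nofun rfl
  obtain ⟨P, n, p, hn, hP⟩ := PolyTime.searchStart r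
  obtain ⟨Q, m, q, hm, hQ⟩ := PolyTime.exec_loop hc
    (f := fun x => searchStep r x.1) ((PolyTime.searchStep r).comp (PolyTime.val PolyTime.id))
  obtain ⟨a, ha⟩ := (PolyTime.added (α := AVInstance) r PolyTime.id).size_le
  obtain ⟨l, hl⟩ := (PolyTime.letters (α := AVInstance) r PolyTime.id).size_le
  refine ⟨.seq P (.seq Q (.assign 0 (.hd (.tl (.var 0))))),
    p + 2 * q.comp (10 + Polynomial.X + (a * (l + 1) + 1)) + 4, fun I => ?_⟩
  obtain ⟨-, s1, r1, e1, -⟩ := hP I (inputStore I.encode) (by simp [inputStore]; rfl)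
  have hword := isWord_replicate (I.letters r) (I.added r)
  set w := List.replicate (I.added r) (I.letters r) with hwdef
  have hwl : w.length = I.added r := by simp [hwdef]
  obtain ⟨h1, h2, h3, h4⟩ := search_result r I hword false rfl
  set N := rank (I.letters r).length w + 1 with hNdef
  -- Without letters the search still makes one step, although the power may be 0; hence the
  -- maximum.
  have hNle : N ≤ max 1 ((I.letters r).length ^ I.added r) := by
    by_cases hK : I.letters r = []
    · rw [hNdef, rank_zero (by rwa [hK] at hword)]
      exact le_max_left _ _
    · rw [hNdef, rank_replicate hK]
      exact le_max_right _ _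
  -- The 10 covers the two flags and the pairing nodes; the last summand bounds a word of `added`
  -- letters, each no larger than `letters`.
  obtain ⟨s2, r2, e2, -⟩ := hQ
    (10 + csize I + (a.eval (csize I) * (l.eval (csize I) + 1) + 1)) N
    (fun i => (searchStep r)^[i] (true, false, I, w))
    (fun i hi => ⟨h1 i hi, Function.iterate_succ_apply' _ _ _⟩) (by simp [h2])
    (fun i _ => by
      obtain ⟨o', b', w', hx, hw', hlen⟩ := search_invariant r I hword true false i
      rw [hx]
      simp only [csize_mk]
      have h5 := csize_bool_le o'
      have h6 := csize_bool_le b'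
      have h7 := csize_le_length_mul (l := w') (B := l.eval (csize I)) fun s hs =>
        ((hw' s hs).1.sublist.csize_le).trans (hl I)
      have h8 : w'.length ≤ a.eval (csize I) := by
        have := ha I
        rw [csize_nat] at this
        omega
      have h9 := Nat.mul_le_mul_right (l.eval (csize I) + 1) h8
      omega) s1 e1
  obtain ⟨t, ht, hex⟩ := r1.seq (r2.seq (Run.assign 0 (.hd (.tl (.var 0))) s2))
  refine ⟨t, _, hex, ht.trans ?_, ?_, ?_⟩
  · change _ ≤ _ * Polynomial.eval (csize I) _
    simp only [Expr.cost, Polynomial.eval_add, Polynomial.eval_mul, Polynomial.eval_comp,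
      Polynomial.eval_X, Polynomial.eval_one, Polynomial.eval_ofNat]
    set M := max 1 ((I.letters r).length ^ I.added r)
    set u := q.eval (10 + csize I + (a.eval (csize I) * (l.eval (csize I) + 1) + 1))
    have hM : 1 ≤ M := le_max_left _ _
    calc p.eval (csize I) + ((N + 1) * u + (1 + 1 + 1 + 1))
        ≤ M * p.eval (csize I) + ((M + M) * u + M * 4) := by
          gcongr
          · exact Nat.le_mul_of_pos_left _ hM
          · omega
      _ = M * (p.eval (csize I) + 2 * u + 4) := by ring
  all_goals
    simp only [Function.update_self, Expr.eval, e2]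
    have hcode : ∀ x : SearchState, (code x).tl.hd ≠ Data.nil ↔ x.2.1 = true := by
      rintro ⟨o, _ | _, x⟩
      · exact iff_of_false (fun h => h rfl) nofun
      · exact iff_of_true nofun rfl
    rw [hcode]
  · intro h
    simpa [hwl] using h3 h
  · rintro ⟨X, hX, hmem, hacc⟩
    obtain ⟨w', hw', rfl⟩ := exists_word [] hmem
    refine h4 (.inr ⟨w', hw', ?_, ?_, hacc⟩)
    · simpa [hwl] using hX
    · by_cases hK : I.letters r = []
      · rw [rank_zero (by rwa [hK] at hw')]
        exact Nat.zero_le _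
      · have h5 := rank_lt hK hw'
        have h6 := rank_replicate hK (I.added r)
        rw [← hwdef] at h6
        rw [show w'.length = I.added r by simpa using hX] at h5
        omega

end AVInstance

/-! ### The kernel -/

/-- Lists are only ever added, so degrees never drop: a set that causes a rejection is still
saturated at the end. -/
theorem sublist_foldl_kernel {ι : Type} [BEq ι] (d B : ℕ) (H K : List (List ι)) :
    K.Sublist (H.foldl (fun K v => bif saturated d d 0 B K [] v then K else v :: K) K) := by
  induction H generalizing K with
  | nil => exact List.Sublist.refl _
  | cons v H ih =>
    refine List.Sublist.trans ?_ (ih _)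
    cases h : saturated d d 0 B K [] v <;> simp [h]

/-- The number of lists in `K` that contain the set `S`. -/
def setDegree {ι : Type} [DecidableEq ι] (K : List (List ι)) (S : Finset ι) : ℕ :=
  K.countP fun u => decide (S ⊆ u.toFinset)

theorem setDegree_cons {ι : Type} [DecidableEq ι] (K : List (List ι)) (v : List ι) (S : Finset ι) :
    setDegree (v :: K) S = setDegree K S + if S ⊆ v.toFinset then 1 else 0 := by
  simp [setDegree, List.countP_cons]

section Kernel

variable {ι : Type} [BEq ι] [LawfulBEq ι] [DecidableEq ι]

theorem contained_iff {x y : List ι} : contained x y = true ↔ x.toFinset ⊆ y.toFinset := by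
  simp [contained, Finset.subset_iff]

theorem sameSet_iff {x y : List ι} : sameSet x y = true ↔ x.toFinset = y.toFinset := by
  simp [sameSet, contained_iff, Finset.Subset.antisymm_iff]

theorem degree_eq (K : List (List ι)) (A : List ι) : degree K A = setDegree K A.toFinset :=
  List.countP_congr fun u _ => by simp [contained_iff]

theorem saturated_iff_sublist (d n j B : ℕ) (K : List (List ι)) (A v : List ι)
    (hv : v.length ≤ n) : saturated d n j B K A v = true ↔ ∃ u : List ι, u.Sublist v ∧
      B ^ (d - (j + u.length)) ≤ setDegree K (u.toFinset ∪ A.toFinset) := by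
  induction n generalizing j A v with
  | zero =>
    obtain rfl : v = [] := List.length_eq_zero_iff.1 (by omega)
    simp [saturated, degree_eq]
  | succ n ih =>
    rcases v with _ | ⟨c, v⟩
    · simp [saturated, degree_eq]
    · have hv : v.length ≤ n := by simpa using hv
      simp only [saturated, Bool.or_eq_true_iff, ih _ _ _ hv, List.sublist_cons_iff]
      constructor
      · rintro (⟨u, hu, h⟩ | ⟨u, hu, h⟩)
        · refine ⟨c :: u, .inr ⟨u, rfl, hu⟩, ?_⟩
          rw [List.toFinset_cons, Finset.union_insert] at h
          rw [List.toFinset_cons, Finset.insert_union, List.length_cons]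
          rwa [show j + (u.length + 1) = j + 1 + u.length by ring]
        · exact ⟨u, .inl hu, h⟩
      · rintro ⟨_, hu | ⟨u, rfl, hu⟩, h⟩
        · exact .inr ⟨_, hu, h⟩
        · refine .inl ⟨u, hu, ?_⟩
          rw [List.toFinset_cons, Finset.insert_union, List.length_cons] at h
          rw [List.toFinset_cons, Finset.union_insert]
          rwa [show j + (u.length + 1) = j + 1 + u.length by ring] at h

/-- For a list without repetitions, sublists yield exactly the subsets, with length equal to
cardinality. -/
theorem saturated_iff {d B : ℕ} {K : List (List ι)} {v : List ι} (hv : v.length ≤ d)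
    (hn : v.Nodup) : saturated d d 0 B K [] v = true ↔
      ∃ S ⊆ v.toFinset, B ^ (d - S.card) ≤ setDegree K S := by
  rw [saturated_iff_sublist _ _ _ _ _ _ _ hv]
  simp only [zero_add, List.toFinset_nil, Finset.union_empty]
  constructor
  · rintro ⟨u, hu, h⟩
    refine ⟨u.toFinset, fun x hx => ?_, ?_⟩
    · simpa using hu.subset (by simpa using hx)
    · rwa [List.toFinset_card_of_nodup (hu.nodup hn)]
  · rintro ⟨S, hS, h⟩
    have hS' : (v.filter (· ∈ S)).toFinset = S := by
      ext x
      simp only [List.mem_toFinset, List.mem_filter, decide_eq_true_eq, and_iff_right_iff_imp]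
      exact fun hx => by simpa using hS hx
    refine ⟨v.filter (· ∈ S), List.filter_sublist, ?_⟩
    rwa [hS', ← List.toFinset_card_of_nodup (hn.filter _), hS']

/-- A list is added only if every subset of it is strictly below its bound, and each degree then
rises by at most one. -/
theorem setDegree_foldl_le (d B : ℕ) (H K : List (List ι))
    (hH : ∀ v ∈ H, v.length ≤ d ∧ v.Nodup) (hK : ∀ S, setDegree K S ≤ B ^ (d - S.card))
    (S : Finset ι) :
    setDegree (H.foldl (fun K v => bif saturated d d 0 B K [] v then K else v :: K) K) S
      ≤ B ^ (d - S.card) := by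
  induction H generalizing K with
  | nil => exact hK S
  | cons v H ih =>
    obtain ⟨hl, hn⟩ := hH v List.mem_cons_self
    refine ih _ (fun u hu => hH u (List.mem_cons_of_mem _ hu)) fun T => ?_
    by_cases h : saturated d d 0 B K [] v = true
    · simpa [h] using hK T
    · simp only [h, cond_false, setDegree_cons]
      rw [saturated_iff hl hn] at h
      push Not at h
      split_ifs with hT
      · exact h T hT
      · exact hK T

theorem setDegree_kernel_le {d B : ℕ} {H : List (List ι)}
    (hH : ∀ v ∈ H, v.length ≤ d ∧ v.Nodup) (S : Finset ι) :
    setDegree (kernel d B H) S ≤ B ^ (d - S.card) :=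
  setDegree_foldl_le d B H [] hH (fun _ => Nat.zero_le _) S

theorem length_kernel_le {d B : ℕ} {H : List (List ι)}
    (hH : ∀ v ∈ H, v.length ≤ d ∧ v.Nodup) : (kernel d B H).length ≤ B ^ d := by
  have := setDegree_kernel_le (B := B) hH ∅
  simpa [setDegree] using this

theorem mem_kernel_or_saturated {d B : ℕ} {H : List (List ι)}
    (hH : ∀ v ∈ H, v.length ≤ d ∧ v.Nodup) {v : List ι} (hv : v ∈ H) :
    v ∈ kernel d B H ∨ ∃ S ⊆ v.toFinset, B ^ (d - S.card) ≤ setDegree (kernel d B H) S := by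
  obtain ⟨H₁, H₂, rfl⟩ := List.append_of_mem hv
  obtain ⟨hl, hn⟩ := hH v hv
  simp only [kernel, List.foldl_append, List.foldl_cons]
  set K := H₁.foldl (fun K v => bif saturated d d 0 B K [] v then K else v :: K) []
  have hsub := sublist_foldl_kernel d B H₂ (bif saturated d d 0 B K [] v then K else v :: K)
  by_cases h : saturated d d 0 B K [] v = true
  · right
    obtain ⟨S, hS, hd⟩ := (saturated_iff hl hn).1 h
    simp only [h, cond_true] at hsub ⊢
    exact ⟨S, hS, hd.trans hsub.countP_le⟩
  · left
    simp only [h, cond_false] at hsub ⊢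
    exact hsub.subset List.mem_cons_self

/-- A union bound. -/
theorem countP_le_sum {α κ : Type} (F : Finset κ) (p : α → Bool) (q : κ → α → Bool) (K : List α)
    (h : ∀ u ∈ K, p u = true → ∃ f ∈ F, q f u = true) :
    K.countP p ≤ ∑ f ∈ F, K.countP (q f) := by
  induction K with
  | nil => simp
  | cons u K ih =>
    have ih := ih fun w hw => h w (List.mem_cons_of_mem _ hw)
    simp only [List.countP_cons, Finset.sum_add_distrib]
    refine add_le_add ih ?_
    split_ifs with hp
    · obtain ⟨f, hf, hq⟩ := h u List.mem_cons_self hp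
      have := Finset.single_le_sum (f := fun f => if q f u = true then 1 else 0)
        (fun _ _ => Nat.zero_le _) hf
      simpa [hq] using this
    · exact Nat.zero_le _

/-- The kernel represents all lists with respect to avoiding fewer than `B` elements. -/
theorem kernel_represents {d B : ℕ} {H : List (List ι)}
    (hH : ∀ v ∈ H, v.length ≤ d ∧ v.Nodup) {v : List ι} (hv : v ∈ H) {F : Finset ι}
    (hF : F.card < B) (hvF : Disjoint v.toFinset F) :
    ∃ u ∈ kernel d B H, Disjoint u.toFinset F := by
  rcases mem_kernel_or_saturated (B := B) hH hv with h | ⟨S, hS, hd⟩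
  · exact ⟨v, h, hvF⟩
  -- Suppose every kept list meets F. Then each one containing the saturated S contains `insert f S`
  -- for some f in F, a set larger by one since v contains S and avoids F.
  by_contra! hcon
  obtain ⟨hl, hn⟩ := hH v hv
  have hSd : S.card ≤ d :=
    (Finset.card_le_card hS).trans ((List.toFinset_card_le v).trans hl)
  have hsum : setDegree (kernel d B H) S ≤
      ∑ f ∈ F, setDegree (kernel d B H) (insert f S) := by
    refine countP_le_sum F _ _ _ fun u hu hSu => ?_
    obtain ⟨f, hf1, hf2⟩ := Finset.not_disjoint_iff.1 (hcon u hu)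
    refine ⟨f, hf2, ?_⟩
    simp only [decide_eq_true_eq] at hSu ⊢
    exact Finset.insert_subset hf1 hSu
  have hcard : ∀ f ∈ F, (insert f S).card = S.card + 1 := fun f hf =>
    Finset.card_insert_of_notMem fun hfS => Finset.disjoint_left.1 hvF (hS hfS) hf
  rcases hSd.lt_or_eq with hlt | heq
  · have h1 : ∑ f ∈ F, setDegree (kernel d B H) (insert f S) ≤
        F.card * B ^ (d - (S.card + 1)) := by
      rw [← smul_eq_mul]
      refine Finset.sum_le_card_nsmul _ _ _ fun f hf => ?_
      rw [← hcard f hf]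
      exact setDegree_kernel_le hH _
    have h2 : B ^ (d - S.card) = B * B ^ (d - (S.card + 1)) := by
      rw [← pow_succ']
      congr 1
      omega
    have h3 : 0 < B ^ (d - (S.card + 1)) := pow_pos (by omega) _
    have h4 := Nat.mul_lt_mul_of_pos_right hF h3
    omega
  -- If |S| = d, no kept list has room for d + 1 elements, whereas saturation of S promises at least
  -- one list containing it.
  · have h1 : ∑ f ∈ F, setDegree (kernel d B H) (insert f S) = 0 := by
      refine Finset.sum_eq_zero fun f hf => List.countP_eq_zero.2 fun u hu => ?_
      have h2 := (hH u (by simpa using (kernel_sublist d B H).subset hu)).1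
      have h3 := hcard f hf
      simp only [decide_eq_true_eq]
      intro h4
      have h5 := Finset.card_le_card h4
      have h6 := u.toFinset_card_le
      omega
    simp only [heq, Nat.sub_self, pow_zero] at hd
    omega

end Kernel

/-! ### The exchange argument -/

section Exchange

variable {ι : Type} [DecidableEq ι]

/-- If the sets in `L` represent the sets in `P`, a solution can be found among the sets in `L`. -/
theorem exists_solution_of_represents {P : Multiset (Finset ι)} {L : Set (Finset ι)} {d e k t : ℕ}
    {b : ι → ℕ} (hcard : ∀ x ∈ P, x.card = e) (he : e ≤ d)
    (hL : 0 < k → ∀ x ∈ P, (∀ c ∈ x, b c + 2 ≤ t) → ∀ F : Finset ι, F.card ≤ d * (k - 1) →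
      Disjoint x F → ∃ y ∈ L, y ∈ P ∧ (∀ c ∈ y, b c + 2 ≤ t) ∧ Disjoint y F)
    {X : Multiset (Finset ι)} (hXP : X ≤ P) (hXk : X.card = k)
    (hX : ∀ c, ∀ x ∈ X, c ∈ x → b c + X.countP (c ∈ ·) + 1 ≤ t) :
    ∃ Y ≤ P, Y.card = k ∧ (∀ x ∈ Y, x ∈ L) ∧
      ∀ c, b c + Y.countP (c ∈ ·) + 1 ≤ t ∨ Y.countP (c ∈ ·) ≤ X.countP (c ∈ ·) := by
  classical
  -- Induction on the number of members outside `L`. The conclusion compares counts with those in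
  -- `X` because `hX` says nothing about elements that do not occur in `X`.
  induction hm : X.countP (· ∉ L) generalizing X with
  | zero =>
    refine ⟨X, hXP, hXk, fun x hx => ?_, fun c => .inr le_rfl⟩
    by_contra h
    exact Multiset.countP_eq_zero.1 hm x hx h
  | succ m ih =>
    obtain ⟨v, hvX, hvL⟩ := Multiset.countP_pos.1 (by omega : 0 < X.countP (· ∉ L))
    obtain ⟨Y, rfl⟩ := Multiset.exists_cons_of_mem hvX
    have hYk : Y.card = k - 1 := by rw [← hXk]; simp
    set U : Finset ι := Y.toFinset.biUnion fun x => x with hU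
    have hUY : ∀ {y c}, y ∈ Y → c ∈ y → c ∈ U := fun {y c} hy hc =>
      Finset.mem_biUnion.2 ⟨y, Multiset.mem_toFinset.2 hy, hc⟩
    have hYP : Y ≤ P := (Multiset.le_cons_self Y v).trans hXP
    have hvP : v ∈ P := Multiset.mem_of_le hXP hvX
    -- The set v itself contributes one to the count, which turns the `+ 1` of `hX` into `+ 2`.
    have hgood : ∀ c ∈ v, b c + 2 ≤ t := fun c hc => by
      have := hX c v hvX hc
      simp only [Multiset.countP_cons, hc, if_true] at this
      omega
    have hF : (U \ v).card ≤ d * (k - 1) := by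
      calc (U \ v).card ≤ U.card := Finset.card_le_card Finset.sdiff_subset
        _ ≤ Y.toFinset.card * d := Finset.card_biUnion_le_card_mul _ _ _ fun x hx => by
            rw [hcard x (Multiset.mem_of_le hYP (Multiset.mem_toFinset.1 hx))]
            exact he
        _ ≤ (k - 1) * d := Nat.mul_le_mul_right _ (hYk ▸ Multiset.toFinset_card_le _)
        _ = d * (k - 1) := mul_comm _ _
    obtain ⟨u, huL, huP, hugood, huF⟩ :=
      hL (by simp at hXk; omega) v hvP hgood _ hF Finset.disjoint_sdiff
    have huv : u ≠ v := fun h => hvL (h ▸ huL)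
    have hfresh : ∀ c ∈ u, c ∉ v → ∀ y ∈ Y, c ∉ y := fun c hcu hcv y hy hcy =>
      Finset.disjoint_left.1 huF hcu (Finset.mem_sdiff.2 ⟨hUY hy hcy, hcv⟩)
    -- Equal cardinality and u ≠ v give u an element outside v; that element occurs nowhere in `Y`.
    -- So u is not yet used, and the exchange respects the multiplicities in `P`.
    obtain ⟨c₀, hc₀u, hc₀v⟩ : ∃ c ∈ u, c ∉ v := by
      by_contra! h
      exact huv (Finset.eq_of_subset_of_card_le h (by rw [hcard u huP, hcard v hvP]))
    have huY : u ∉ Y := fun h => hfresh c₀ hc₀u hc₀v u h hc₀u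
    have hcount : ∀ c, b c + (u ::ₘ Y).countP (c ∈ ·) + 1 ≤ t ∨
        (u ::ₘ Y).countP (c ∈ ·) ≤ (v ::ₘ Y).countP (c ∈ ·) := by
      intro c
      by_cases hcu : c ∈ u
      · by_cases hcv : c ∈ v
        · right
          simp [hcu, hcv]
        · left
          have : Y.countP (c ∈ ·) = 0 := Multiset.countP_eq_zero.2 (hfresh c hcu hcv)
          have := hugood c hcu
          simp [hcu]
          omega
      · right
        simp only [Multiset.countP_cons, hcu, if_false]
        omega
    obtain ⟨Z, hZP, hZk, hZL, hZ⟩ := ih (X := u ::ₘ Y) (by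
        rw [Multiset.le_iff_count]
        intro x
        rw [Multiset.count_cons]
        split_ifs with hx
        · subst hx
          rw [Multiset.count_eq_zero_of_notMem huY]
          exact Multiset.one_le_count_iff_mem.2 huP
        · exact Multiset.le_iff_count.1 hYP x) (by simpa using hXk)
      (fun c x hx hcx => by
        rcases hcount c with h | h
        · exact h
        · have hpos : 0 < (u ::ₘ Y).countP (c ∈ ·) := Multiset.countP_pos.2 ⟨x, hx, hcx⟩
          obtain ⟨x', hx', hcx'⟩ := Multiset.countP_pos.1 (hpos.trans_le h)
          have := hX c x' hx' hcx'
          omega)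
      (by
        simp only [Multiset.countP_cons, hvL, not_false_eq_true, if_true] at hm
        simp only [Multiset.countP_cons, huL, not_true_eq_false, if_false]
        omega)
    refine ⟨Z, hZP, hZk, hZL, fun c => ?_⟩
    rcases hZ c with h | h
    · exact .inl h
    · rcases hcount c with h' | h'
      · exact .inl (by omega)
      · exact .inr (h.trans h')

end Exchange

/-! ### Correctness -/

theorem Multiset.exists_le_map_eq {α β : Type} {f : α → β} {T : Multiset α} {X : Multiset β}
    (h : X ≤ T.map f) : ∃ S ≤ T, S.map f = X := by
  have h1 : X ∈ Multiset.powersetCard X.card (T.map f) := Multiset.mem_powersetCard.2 ⟨h, rfl⟩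
  rw [Multiset.powersetCard_map] at h1
  obtain ⟨S, hS, rfl⟩ := Multiset.mem_map.1 h1
  exact ⟨S, (Multiset.mem_powersetCard.1 hS).1, rfl⟩

theorem Multiset.exists_le_card {α : Type} {S T : Multiset α} (h : S ≤ T) {k : ℕ}
    (hS : S.card ≤ k) (hT : k ≤ T.card) : ∃ U, S + U ≤ T ∧ (S + U).card = k := by
  obtain ⟨D, rfl⟩ := Multiset.le_iff_exists_add.1 h
  induction D using Quotient.inductionOn with | _ l
  refine ⟨↑(l.take (k - S.card)), add_le_add_right (List.take_sublist _ _).subperm S, ?_⟩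
  simp only [Multiset.card_add, Multiset.quot_mk_to_coe, Multiset.coe_card,
    List.length_take] at hT ⊢
  omega

/-- The name of a candidate. -/
def candidateName {m : ℕ} (c : Fin m) : List Bool := (c : ℕ).bits

theorem candidateName_injective {m : ℕ} : Function.Injective (candidateName (m := m)) := by
  intro c d h
  have := congrArg ofBits h
  simp only [candidateName, ofBits_bits] at this
  exact Fin.ext this

namespace AVInstance

variable {m : ℕ} (r : ℕ)

theorem ballot_nodup (v : Vote m) : (ballot v).Nodup :=
  (List.nodup_finRange m).map (candidateName_injective.comp v.injective)

theorem mem_take_ballot (v : Vote m) (c : Fin m) :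
    candidateName c ∈ (ballot v).take r ↔ v.Approves r c := by
  rw [List.mem_take_iff_getElem]
  simp only [ballot, List.getElem_map, List.getElem_finRange, List.length_map,
    List.length_finRange, Vote.Approves]
  constructor
  · rintro ⟨i, hi, h⟩
    have h1 := candidateName_injective (a₁ := v _) h
    rw [← h1]
    simp
    omega
  · intro h
    exact ⟨(v.symm c : ℕ), by have := (v.symm c).2; omega, by simp [candidateName]⟩

theorem exists_of_mem_ballot {v : Vote m} {x : List Bool} (h : x ∈ ballot v) :
    ∃ c : Fin m, x = candidateName c := by
  obtain ⟨i, -, rfl⟩ := List.mem_map.1 h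
  exact ⟨v i, rfl⟩

theorem load_ballots (V : List (Vote m)) (c : Fin m) :
    load ((V.map ballot).map (List.take r)) (candidateName c) = score r (V : Multiset _) c := by
  simp only [load, score, Multiset.coe_countP, List.map_map, List.countP_map]
  refine List.countP_congr fun v _ => ?_
  simp [mem_take_ballot]

/-- The candidates other than `p` that a vote approves. -/
def stripped (p : Fin m) (v : Vote m) : List (List Bool) :=
  ((ballot v).take r).filter fun c => !(c == candidateName p)

theorem mem_stripped {p c : Fin m} {v : Vote m} :
    candidateName c ∈ stripped r p v ↔ v.Approves r c ∧ c ≠ p := by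
  simp [stripped, mem_take_ballot, candidateName_injective.eq_iff]

theorem exists_of_mem_stripped {p : Fin m} {v : Vote m} {x : List Bool} (h : x ∈ stripped r p v) :
    ∃ c : Fin m, x = candidateName c ∧ v.Approves r c ∧ c ≠ p := by
  obtain ⟨c, rfl⟩ := exists_of_mem_ballot (List.mem_of_mem_take (List.mem_of_mem_filter h))
  exact ⟨c, rfl, (mem_stripped r).1 h⟩

theorem stripped_nodup (p : Fin m) (v : Vote m) : (stripped r p v).Nodup :=
  ((ballot_nodup v).sublist (List.take_sublist _ _)).filter _

/-- The size does not depend on the vote, as the exchange argument requires; the minimum covers the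
case of fewer than r candidates. -/
theorem length_stripped {p : Fin m} {v : Vote m} (h : v.Approves r p) :
    (stripped r p v).length = min r m - 1 := by
  have hn := (ballot_nodup v).sublist (List.take_sublist r _)
  have h1 := List.Nodup.erase_eq_filter hn (candidateName p)
  have h2 := List.length_erase_of_mem ((mem_take_ballot r v p).2 h)
  rw [h1] at h2
  rw [stripped, show min r m = ((ballot v).take r).length by simp [ballot], ← h2]
  rfl

/-- The unregistered votes that approve the distinguished candidate. -/
def supporters (I : AVInstance) : List (Vote I.m) :=
  I.unregistered.filter fun v => decide (v.Approves r I.p)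

theorem pool_eq (I : AVInstance) : I.pool r = (I.supporters r).map (stripped r I.p) := by
  rw [pool, supporters, List.map_map, List.filter_map, List.map_map]
  congr 1
  refine List.filter_congr fun v _ => ?_
  rw [show I.distinguished = candidateName I.p from rfl]
  simpa [Function.comp] using mem_take_ballot r v I.p

theorem added_eq (I : AVInstance) : I.added r = min I.R (I.supporters r).length := by
  simp [added, pool_eq]

theorem base_eq (I : AVInstance) (c : Fin I.m) :
    I.base r (candidateName c) = score r (I.registered : Multiset _) c := load_ballots r _ c

theorem score_add (V W : Multiset (Vote m)) (c : Fin m) :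
    score r (V + W) c = score r V c + score r W c := Multiset.countP_add _ _ _

theorem score_le_card (V : Multiset (Vote m)) (c : Fin m) : score r V c ≤ V.card :=
  Multiset.countP_le_card _ _

theorem score_eq_card {V : Multiset (Vote m)} {p : Fin m} (h : ∀ v ∈ V, v.Approves r p) :
    score r V p = V.card := Multiset.countP_eq_card.2 h

theorem isUniqueWinner_iff (W : Multiset (Vote m)) (p : Fin m) :
    IsUniqueWinner r W p ↔ ∀ c, c ≠ p → score r W c < score r W p := by
  constructor
  · rintro ⟨h1, h2⟩ c hc
    refine lt_of_le_of_ne (h1 c) fun h => hc (h2 c fun d => ?_)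
    rw [h]
    exact h1 d
  · intro h
    refine ⟨fun d => ?_, fun d hd => ?_⟩
    · by_cases hdp : d = p
      · rw [hdp]
      · exact (h d hdp).le
    · by_contra hdp
      exact absurd (hd p) (h d hdp).not_ge

/-- It suffices to add votes for the distinguished candidate, as many as possible. -/
theorem exists_supporters_of_isYes {I : AVInstance} (h : I.IsYes r) :
    ∃ S ≤ (I.supporters r : Multiset (Vote I.m)), S.card = I.added r ∧
      IsUniqueWinner r ((I.registered : Multiset _) + S) I.p := by
  obtain ⟨S, hST, hSR, hS⟩ := h
  have h1 : S.filter (fun v => v.Approves r I.p) ≤ (I.supporters r : Multiset (Vote I.m)) := by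
    rw [supporters, ← Multiset.filter_coe]
    exact Multiset.filter_le_filter _ hST
  obtain ⟨U, hU, hUk⟩ := Multiset.exists_le_card h1 (k := I.added r) (by
      rw [added_eq]
      refine le_min ((Multiset.card_le_card (Multiset.filter_le _ _)).trans hSR) ?_
      simpa using Multiset.card_le_card h1) (by
      rw [added_eq]
      exact min_le_right _ _)
  refine ⟨_, hU, hUk, ?_⟩
  rw [isUniqueWinner_iff] at hS ⊢
  intro c hc
  have h2 := hS c hc
  have h3 : score r S I.p = score r (S.filter fun v => v.Approves r I.p) I.p := by
    simp [score, Multiset.countP_eq_card_filter]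
  have h4 : score r (S.filter fun v => v.Approves r I.p) c ≤ score r S c :=
    Multiset.countP_le_of_le _ (Multiset.filter_le _ _)
  have h5 := score_le_card r U c
  have h6 : score r U I.p = U.card := score_eq_card r fun v hv => by
    have := Multiset.mem_of_le hU (Multiset.mem_add.2 (.inr hv))
    simpa [supporters] using (List.mem_filter.1 (Multiset.mem_coe.1 this)).2
  simp only [score_add] at h2 ⊢
  omega

/-- The set of candidates other than `p` that a vote approves. -/
def rivalSet (p : Fin m) (v : Vote m) : Finset (List Bool) := (stripped r p v).toFinset

theorem countP_mem_map_rivalSet (S : Multiset (Vote m)) {p c : Fin m} (hc : c ≠ p) :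
    (S.map (rivalSet r p)).countP (candidateName c ∈ ·) = score r S c := by
  rw [Multiset.countP_map, score, Multiset.countP_eq_card_filter]
  congr 1
  refine Multiset.filter_congr fun v _ => ?_
  simp [rivalSet, mem_stripped, hc]

theorem map_toFinset_pool (I : AVInstance) :
    (((I.pool r).map List.toFinset : List _) : Multiset (Finset (List Bool))) =
      (I.supporters r : Multiset (Vote I.m)).map (rivalSet r I.p) := by
  rw [pool_eq, List.map_map]
  rfl

theorem load_eq_countP (X : List (List (List Bool))) (c : List Bool) :
    load X c = ((X.map List.toFinset : List _) : Multiset (Finset (List Bool))).countP (c ∈ ·) := by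
  simp only [load, Multiset.coe_countP, List.countP_map]
  exact List.countP_congr fun v _ => by simp

theorem countP_sameSet (X : List (List (List Bool))) (x : List (List Bool)) :
    X.countP (sameSet x) =
      ((X.map List.toFinset : List _) : Multiset (Finset (List Bool))).count x.toFinset := by
  rw [Multiset.coe_count, List.count, List.countP_map]
  refine List.countP_congr fun v _ => ?_
  simp only [sameSet_iff, Function.comp, beq_iff_eq]
  exact eq_comm

/-- Votes matter only through their sets of rivals, so availability is tested by comparing
multiplicities of sets; sets not occurring in `X` need no test. -/
theorem accepts_iff (I : AVInstance) (X : List (List (List Bool))) :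
    I.accepts r X = true ↔
      ((X.map List.toFinset : List _) : Multiset (Finset (List Bool))) ≤
        (I.supporters r : Multiset (Vote I.m)).map (rivalSet r I.p) ∧
      ∀ c : Fin I.m, c ≠ I.p → score r (I.registered : Multiset _) c +
        load X (candidateName c) < score r (I.registered : Multiset _) I.p + I.added r := by
  rw [accepts, Bool.and_eq_true, List.all_eq_true, List.all_eq_true, ← map_toFinset_pool]
  refine and_congr ?_ ?_
  · simp only [Nat.ble_eq, countP_sameSet, Multiset.le_iff_count]
    refine ⟨fun h x => ?_, fun h x _ => h _⟩
    by_cases hx : x ∈ X.map List.toFinset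
    · obtain ⟨y, hy, rfl⟩ := List.mem_map.1 hx
      exact h y hy
    · rw [Multiset.count_eq_zero_of_notMem (by simpa using hx)]
      exact Nat.zero_le _
  · have hd : I.distinguished = candidateName I.p := rfl
    simp only [cands, List.mem_map, List.mem_range, Bool.or_eq_true, beq_iff_eq, Nat.ble_eq,
      forall_exists_index, and_imp, forall_apply_eq_imp_iff₂, target, hd, base_eq]
    constructor
    · intro h c hc
      rcases h c c.2 with h | h
      · exact absurd (candidateName_injective h) hc
      · rw [← base_eq]
        exact h
    · intro h i hi
      by_cases hp : (⟨i, hi⟩ : Fin I.m) = I.p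
      · exact .inl (congrArg candidateName hp)
      · right
        have := h ⟨i, hi⟩ hp
        rw [← base_eq] at this
        exact this

/-- A submultiset of the image of the supporters lifts to a submultiset of the supporters, whose
rivals' scores are the counts in `X`. -/
theorem isYes_of_accepts {I : AVInstance} {X : List (List (List Bool))}
    (hX : X.length = I.added r) (h : I.accepts r X = true) : I.IsYes r := by
  obtain ⟨h1, h2⟩ := (accepts_iff r I X).1 h
  obtain ⟨S, hS, hSX⟩ := Multiset.exists_le_map_eq h1
  have hcard : S.card = I.added r := by
    rw [← hX, ← Multiset.card_map (rivalSet r I.p) S, hSX]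
    simp
  have hp : score r S I.p = S.card := score_eq_card r fun v hv => by
    simpa [supporters] using (List.mem_filter.1 (Multiset.mem_coe.1 (Multiset.mem_of_le hS hv))).2
  refine ⟨S, hS.trans (List.filter_sublist.subperm), ?_, ?_⟩
  · rw [hcard, added_eq]
    exact min_le_left _ _
  · rw [isUniqueWinner_iff]
    intro c hc
    have := h2 c hc
    rw [load_eq_countP, ← hSX, countP_mem_map_rivalSet r S hc] at this
    simp only [score_add]
    omega

theorem usable_spec {I : AVInstance} {v : List (List Bool)} (hv : v ∈ I.usable r) :
    v.length ≤ r - 1 ∧ v.Nodup := by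
  have h1 := List.mem_of_mem_filter hv
  rw [pool_eq] at h1
  obtain ⟨w, hw, rfl⟩ := List.mem_map.1 h1
  rw [length_stripped r (by simpa [supporters] using (List.mem_filter.1 hw).2)]
  exact ⟨by omega, stripped_nodup r _ _⟩

theorem exists_accepts_of_isYes (hr : 1 ≤ r) {I : AVInstance} (h : I.IsYes r) :
    ∃ X, X.length = I.added r ∧ (∀ x ∈ X, x ∈ I.letters r) ∧ I.accepts r X = true := by
  obtain ⟨S, hS, hSk, hwin⟩ := exists_supporters_of_isYes r h
  rw [isUniqueWinner_iff] at hwin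
  have happ : ∀ v ∈ (I.supporters r : Multiset (Vote I.m)), v.Approves r I.p := fun v hv => by
    simpa [supporters] using (List.mem_filter.1 (Multiset.mem_coe.1 hv)).2
  have hSp := score_eq_card r fun v hv => happ v (Multiset.mem_of_le hS hv)
  have hlt : ∀ c, c ≠ I.p → score r (I.registered : Multiset _) c + score r S c <
      score r (I.registered : Multiset _) I.p + I.added r := fun c hc => by
    have := hwin c hc
    simp only [score_add] at this
    omega
  obtain ⟨Y, hYP, hYk, hYL, hY⟩ := exists_solution_of_represents
    (P := (I.supporters r : Multiset (Vote I.m)).map (rivalSet r I.p))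
    (L := {x | ∃ v ∈ I.letters r, v.toFinset = x}) (d := r - 1) (e := min r I.m - 1)
    (k := I.added r) (t := I.target r) (b := I.base r) (X := S.map (rivalSet r I.p))
    (fun x hx => by
      obtain ⟨v, hv, rfl⟩ := Multiset.mem_map.1 hx
      rw [rivalSet, List.toFinset_card_of_nodup (stripped_nodup r _ _),
        length_stripped r (happ v hv)])
    (by omega)
    (fun hk x hx hgood F hF hxF => by
      obtain ⟨v, hv, rfl⟩ := Multiset.mem_map.1 hx
      have hvU : stripped r I.p v ∈ I.usable r := by
        refine List.mem_filter.2 ⟨?_, ?_⟩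
        · rw [pool_eq]
          exact List.mem_map_of_mem (by simpa using hv)
        · simpa [rivalSet] using hgood
      have hkR : I.added r ≤ I.R := min_le_left _ _
      -- Strictness comes from k - 1 < k ≤ R, where k = `added` is positive by `hk`.
      have hFB : F.card < r * I.R := by
        calc F.card ≤ (r - 1) * (I.added r - 1) := hF
          _ ≤ r * (I.added r - 1) := by gcongr; omega
          _ < r * I.R := by gcongr; omega
      obtain ⟨u, hu, huF⟩ := kernel_represents (d := r - 1) (fun v hv => usable_spec r hv) hvU hFB
        hxF
      have huU : u ∈ I.usable r := by simpa using (kernel_sublist _ _ _).subset hu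
      refine ⟨_, ⟨u, hu, rfl⟩, ?_, ?_, huF⟩
      · rw [← map_toFinset_pool]
        exact List.mem_map_of_mem (List.mem_of_mem_filter huU)
      · simpa using (List.mem_filter.1 huU).2)
    (Multiset.map_le_map hS) (by simpa using hSk)
    (fun c x hx hcx => by
      obtain ⟨v, hv, rfl⟩ := Multiset.mem_map.1 hx
      obtain ⟨c, rfl, -, hc⟩ := exists_of_mem_stripped r (List.mem_toFinset.1 hcx)
      rw [countP_mem_map_rivalSet r S hc, base_eq, target,
        show I.distinguished = candidateName I.p from rfl, base_eq]
      exact hlt c hc)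
  -- Choose, for every set in `Y`, a letter that represents it.
  obtain ⟨W, hW, rfl⟩ : ∃ W : List (List (List Bool)), (∀ x ∈ W, x ∈ I.letters r) ∧
      ((W.map List.toFinset : List _) : Multiset (Finset (List Bool))) = Y := by
    clear hY hYk hYP
    induction Y using Multiset.induction_on with
    | empty => exact ⟨[], by simp, rfl⟩
    | cons y Y ih =>
      obtain ⟨W, hW, rfl⟩ := ih fun x hx => hYL x (Multiset.mem_cons_of_mem hx)
      obtain ⟨v, hv, rfl⟩ := hYL y (Multiset.mem_cons_self _ _)
      exact ⟨v :: W, by simpa using ⟨hv, hW⟩, rfl⟩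
  refine ⟨W, by simpa using hYk, hW, (accepts_iff r I W).2 ⟨hYP, fun c hc => ?_⟩⟩
  rw [load_eq_countP]
  rcases hY (candidateName c) with h1 | h1
  · rw [base_eq, target, show I.distinguished = candidateName I.p from rfl, base_eq] at h1
    exact h1
  · rw [countP_mem_map_rivalSet r S hc] at h1
    exact (Nat.add_le_add_left h1 _).trans_lt (hlt c hc)

end AVInstance

/-! ### The running time -/

theorem AVInstance.length_letters_pow_le (r : ℕ) (hr : 1 ≤ r) (I : AVInstance) :
    max 1 ((I.letters r).length ^ I.added r) ≤ (r * I.R) ^ ((r - 1) * I.R) := by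
  have h1 : I.added r ≤ I.R := min_le_left _ _
  -- For R = 0 both sides are 1, by 0^0 = 1; otherwise the base rR is positive and powers are
  -- monotone in the exponent.
  rcases Nat.eq_zero_or_pos I.R with h0 | hpos
  · have : I.added r = 0 := by omega
    simp [h0, this]
  · have hB : 0 < r * I.R := Nat.mul_pos hr hpos
    refine max_le (Nat.one_le_pow _ _ hB) ?_
    calc (I.letters r).length ^ I.added r
        ≤ ((r * I.R) ^ (r - 1)) ^ I.added r :=
          Nat.pow_le_pow_left (length_kernel_le fun v hv => usable_spec r hv) _
      _ ≤ ((r * I.R) ^ (r - 1)) ^ I.R := Nat.pow_le_pow_right (Nat.pow_pos hB) h1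
      _ = _ := by rw [← pow_mul]

theorem computable_mul_pow_mul (a b : ℕ) : Computable fun n : ℕ => (a * n) ^ (b * n) := by
  have h : Primrec₂ fun m n : ℕ => m ^ n := Primrec₂.unpaired'.1 Nat.Primrec.pow
  exact (h.comp (Primrec.nat_mul.comp (Primrec.const a) Primrec.id)
    (Primrec.nat_mul.comp (Primrec.const b) Primrec.id)).to_comp

theorem solvableInOStar_addingVotes (r : ℕ) (hr : 1 ≤ r) :
    SolvableInOStar AVInstance.encode (AVInstance.IsYes r)
      (fun I => (r * I.R) ^ ((r - 1) * I.R)) := by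
  obtain ⟨P, q, h⟩ := AVInstance.exists_search_program r
  refine ⟨P, q, fun I => ?_⟩
  obtain ⟨t, s, hex, ht, h1, h2⟩ := h I
  refine ⟨t, s, hex, ht.trans (Nat.mul_le_mul_right _ (I.length_letters_pow_le r hr)),
    fun hs => ?_, fun hyes => h2 (AVInstance.exists_accepts_of_isYes r hr hyes)⟩
  obtain ⟨X, hX, hacc⟩ := h1 hs
  exact AVInstance.isYes_of_accepts r hX hacc

theorem theorem7 (r : ℕ) (hr : 1 ≤ r) :
    IsFPT AVInstance.encode (AVInstance.IsYes r) AVInstance.R ∧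
      SolvableInOStar AVInstance.encode (AVInstance.IsYes r)
        (fun I => (r * I.R) ^ ((r - 1) * I.R)) :=
  ⟨⟨fun n => (r * n) ^ ((r - 1) * n), computable_mul_pow_mul r (r - 1),
    solvableInOStar_addingVotes r hr⟩, solvableInOStar_addingVotes r hr⟩
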